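/- Notation. For $x\in\mathbb R^4$ write $x=(\underline x,x_4)$ with $\underline x\in\mathbb R^3$; for $w\in\mathbb R^3$ let $w_\times$ be the skew-symmetric matrix of $v\mapsto w\times v$. Let $\mathrm{SE}(3)=\left\{\begin{bmatrix}R&p\\0&1\end{bmatrix}: R\in \mathrm{SO}(3),\,p\in\mathbb R^3\right\}$, $\mathfrak{se}(3)=\left\{\begin{bmatrix}\Omega_\times&V\\0&0\end{bmatrix}:\Omega,V\in\mathbb R^3\right\}$, and let $\mathbf P:\mathbb R^{4\times4}\to\mathfrak{se}(3)$, $\mathbf P\begin{bmatrix}M_1&m_2\\m_3^\top&m_4\end{bmatrix}=\begin{bmatrix}(M_1-M_1^\top)/2&m_2\\0&0\end{bmatrix}$, be the orthogonal projection for the Frobenius inner product. System. Let $A:[0,\infty)\to\mathfrak{se}(3)$ be continuous and let $X:[0,\infty)\to\mathrm{SE}(3)$ satisfy $\dot X=XA$. Let $\mathring y_1,\dots,\mathring y_N$ be constant points of $\mathbb{RP}^3$, represented by unit vectors of $\mathbb R^4$, and let $y_i=X^{-1}\mathring y_i/|X^{-1}\mathring y_i|$ be the measured outputs. Let $A_y=A+b_A$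 be the measured velocity, where $b_A\in\mathfrak{se}(3)$ is constant. Let $k_1,\dots,k_N,k_b>0$. Observer. Consider $$\dot{\hat X}=\hat X(A_y-\hat b_A)-\Delta\hat X,\qquad \dot{\hat b}_A=-k_b\,\mathbf P\!\left(\hat X^\top\sum_{i=1}^N k_i(I_4-e_ie_i^\top)\mathring y_ie_i^\top\hat X^{-\top}\right),$$ with initial values in $\mathrm{SE}(3)$ and $\mathfrak{se}(3)$ respectively, where $e_i=\hat Xy_i/|\hat Xy_i|$ and $\Delta=-\mathbf P\left(\sum_{i=1}^N k_i(I_4-e_ie_i^\top)\mathring y_ie_i^\top\right)$. Put $E=\hat XX^{-1}$ and $\tilde b_A=b_A-\hat b_A$. Assumptions. (a) (Observability) One of the following holds: 1. there are two different points $\mathring y_{i_1},\mathring y_{i_2}$ of $\mathbb{RP}^3$ with $\mathring y_{i_1,4}=\mathring y_{i_2,4}=0$, and a point $\mathring y_{j_1}$ with $\mathring y_{j_1,4}\ne0$; 2. there are a point $\mathring y_{i_1}$ with $\mathring y_{i_1,4}=0$ and two different points $\mathring y_{j_1},\mathring y_{j_2}$ of $\mathbb{RP}^3$ with nonzero fourth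 components, such that $\underline{\mathring y}_{i_1}$ and $v_{j_1j_2}$ are not collinear; 3. there are three pairwise different points $\mathring y_{j_1},\mathring y_{j_2},\mathring y_{j_3}$ of $\mathbb{RP}^3$ with nonzero fourth components, such that $v_{j_1j_2},v_{j_2j_3},v_{j_3j_1}$ are not all collinear. Here $v_{jl}=\mathring y_{l,4}\underline{\mathring y}_j-\mathring y_{j,4}\underline{\mathring y}_l$. (b) With $S=\sum_i k_i\mathring y_{i,4}\,\underline{\mathring y}_{i\times}$, the matrices $\mathring G=\sum_i k_i(\underline{\mathring y}_{i\times})^2$ and $\mathring H=S\mathring G^{-1}S-\sum_i k_i\mathring y_{i,4}^2(I_3-\underline{\mathring y}_i\underline{\mathring y}_i^\top)$ have full rank. (c) $A$ and $X$ are bounded on $[0,\infty)$. Conclusion. The point $(E,\tilde b_A)=(I_4,0)$ is a locally asymptotically stable equilibrium of the non-autonomous dynamics of $(E,\tilde b_A)$ on $\mathrm{SE}(3)\times\mathfrak{se}(3)$. That is, it is an equilibrium, and for every initial time $t_0\ge0$: solutions starting at $t_0$ from all points near $(I_4,0)$ exist on $[t_0,\infty)$; for every $\varepsilon>0$ there is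 $\delta>0$ such that each solution starting at $t_0$ within distance $\delta$ of $(I_4,0)$ stays within distance $\varepsilon$ for as long as it is defined; and there is $\delta>0$ such that each solution on $[t_0,\infty)$ starting within distance $\delta$ of $(I_4,0)$ converges to $(I_4,0)$ as $t\to\infty$. -/

import Mathlib

open scoped Matrix Matrix.Norms.Frobenius Topology
open Filter Set

namespace PoseObserver

/-- Index type of the coordinates of `ℝ⁴ = ℝ³ × ℝ`: `Sum.inl 0, Sum.inl 1, Sum.inl 2` are the
first three coordinates and `Sum.inr ()` is the fourth one. -/
abbrev I4 : Type := Fin 3 ⊕ Unit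

/-- Vectors of `ℝ³`. -/
abbrev V3 : Type := Fin 3 → ℝ

/-- Vectors of `ℝ⁴`. -/
abbrev V4 : Type := I4 → ℝ

/-- Real `3 × 3` matrices. -/
abbrev M3 : Type := Matrix (Fin 3) (Fin 3) ℝ

/-- Real `4 × 4` matrices; their norm is the Frobenius norm. -/
abbrev M4 : Type := Matrix I4 I4 ℝ

/-- The first three components of a vector of `ℝ⁴`. -/
def under (x : V4) : V3 := fun i => x (Sum.inl i)

/-- The fourth component of a vector of `ℝ⁴`. -/
def fourth (x : V4) : ℝ := x (Sum.inr ())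

/-- The skew-symmetric matrix `Ω_×` of the cross product by `Ω`. -/
def skew (w : V3) : M3 :=
  !![0, -w 2, w 1; w 2, 0, -w 0; -w 1, w 0, 0]

theorem skew_mulVec (w v : V3) : skew w *ᵥ v = crossProduct w v := by
  ext i
  fin_cases i <;> simp [skew, cross_apply, Matrix.mulVec, dotProduct, Fin.sum_univ_three] <;> ring

/-- The special Euclidean group, in homogeneous coordinates. -/
def SE3 : Set M4 :=
  {X | ∃ R ∈ Matrix.specialOrthogonalGroup (Fin 3) ℝ, ∃ p : V3,
    X = Matrix.fromBlocks R (Matrix.replicateCol Unit p) 0 1}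

/-- The Lie algebra of `SE3`. -/
def se3 : Set M4 :=
  {A | ∃ w v : V3, A = Matrix.fromBlocks (skew w) (Matrix.replicateCol Unit v) 0 0}

/-- The projection of the `4 × 4` matrices onto `se3`, in block form. -/
noncomputable def proj (M : M4) : M4 :=
  Matrix.fromBlocks ((1 / 2 : ℝ) • (M.toBlocks₁₁ - M.toBlocks₁₁ᵀ)) M.toBlocks₁₂ 0 0

theorem proj_mem_se3 (M : M4) : proj M ∈ se3 := by
  refine ⟨![(M (Sum.inl 2) (Sum.inl 1) - M (Sum.inl 1) (Sum.inl 2)) / 2,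
      (M (Sum.inl 0) (Sum.inl 2) - M (Sum.inl 2) (Sum.inl 0)) / 2,
      (M (Sum.inl 1) (Sum.inl 0) - M (Sum.inl 0) (Sum.inl 1)) / 2],
    fun i => M (Sum.inl i) (Sum.inr ()), ?_⟩
  ext i j
  rcases i with i | i <;> rcases j with j | j
  · fin_cases i <;> fin_cases j <;>
      simp [proj, skew, Matrix.toBlocks₁₁] <;> ring
  · simp [proj, Matrix.toBlocks₁₂]
  · simp [proj]
  · simp [proj]

/-- `proj` is the orthogonal projection onto `se3` for the inner product `tr (M₁ᵀ M₂)`. -/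
theorem trace_transpose_mul_proj (A : M4) (hA : A ∈ se3) (M : M4) :
    (Aᵀ * proj M).trace = (Aᵀ * M).trace := by
  obtain ⟨w, v, rfl⟩ := hA
  simp [Matrix.trace, Matrix.mul_apply, proj, skew, Matrix.toBlocks₁₁, Matrix.toBlocks₁₂,
    Fin.sum_univ_three]
  ring

/-- The vector `x / |x|`, with the Euclidean norm `|x|` of `ℝ⁴`. -/
noncomputable def unitVector (x : V4) : V4 := (Real.sqrt (x ⬝ᵥ x))⁻¹ • x

/-- The output `h(X, z) = X⁻¹ z / |X⁻¹ z|`. -/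
noncomputable def output (X : M4) (z : V4) : V4 := unitVector (X⁻¹ *ᵥ z)

/-- The estimate `e = X̂ y / |X̂ y|` of the reference point seen as the output `y`. -/
noncomputable def outputError (Xh : M4) (y : V4) : V4 := unitVector (Xh *ᵥ y)

variable {N : ℕ}

/-- The matrix `∑ᵢ kᵢ (I₄ - eᵢ eᵢᵀ) zᵢ eᵢᵀ` with `eᵢ = X̂ yᵢ / |X̂ yᵢ|`, where the `zᵢ` are the
reference points and the `yᵢ` are the outputs. -/
noncomputable def innovationSum (k : Fin N → ℝ) (z : Fin N → V4) (Xh : M4) (y : Fin N → V4) : M4 :=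
  ∑ i, k i • ((1 - Matrix.vecMulVec (outputError Xh (y i)) (outputError Xh (y i))) *
    Matrix.vecMulVec (z i) (outputError Xh (y i)))

/-- The innovation term `Δ(X̂, Y)`. -/
noncomputable def innovation (k : Fin N → ℝ) (z : Fin N → V4) (Xh : M4) (y : Fin N → V4) : M4 :=
  -proj (innovationSum k z Xh y)

/-- `(X̂, b̂)` is a solution on the time interval `J`, with initial time `t₀`, of the observer with
gains `k`, `kb`, reference points `z`, measured velocity `Ay` and measured outputs `Y`. -/
structure IsObserverSolution (k : Fin N → ℝ) (kb : ℝ) (z : Fin N → V4)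
    (Ay : ℝ → M4) (Y : ℝ → Fin N → V4) (t₀ : ℝ) (J : Set ℝ) (Xh bh : ℝ → M4) : Prop where
  init_pose : Xh t₀ ∈ SE3
  init_bias : bh t₀ ∈ se3
  pose : ∀ t ∈ J, HasDerivWithinAt Xh
    (Xh t * (Ay t - bh t) - innovation k z (Xh t) (Y t) * Xh t) J t
  bias : ∀ t ∈ J, HasDerivWithinAt bh
    (-(kb • proj ((Xh t)ᵀ * innovationSum k z (Xh t) (Y t) * ((Xh t)ᵀ)⁻¹))) J t

/-- `γ = (E, b̃)` is a trajectory of the error dynamics: `E = X̂ X⁻¹` and `b̃ = b - b̂` on `J` for some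
solution `(X̂, b̂)` of the observer fed with the measured velocity `A + b` and the outputs
`yᵢ = h(X, zᵢ)`. -/
def IsErrorTrajectory (k : Fin N → ℝ) (kb : ℝ) (z : Fin N → V4) (X A : ℝ → M4) (b : M4)
    (t₀ : ℝ) (J : Set ℝ) (γ : ℝ → M4 × M4) : Prop :=
  ∃ Xh bh : ℝ → M4,
    IsObserverSolution k kb z (fun t => A t + b) (fun t i => output (X t) (z i)) t₀ J Xh bh ∧
    ∀ t ∈ J, γ t = (Xh t * (X t)⁻¹, b - bh t)

/-- The three cases of the observability condition. Points of the projective space are given by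
vectors of `ℝ⁴`, and are different when they span different lines. -/
def Observable (z : Fin N → V4) : Prop :=
  (∃ i₁ i₂ j₁, Submodule.span ℝ {z i₁} ≠ Submodule.span ℝ {z i₂} ∧
    fourth (z i₁) = 0 ∧ fourth (z i₂) = 0 ∧ fourth (z j₁) ≠ 0) ∨
  (∃ i₁ j₁ j₂, fourth (z i₁) = 0 ∧ Submodule.span ℝ {z j₁} ≠ Submodule.span ℝ {z j₂} ∧
    fourth (z j₁) ≠ 0 ∧ fourth (z j₂) ≠ 0 ∧
    LinearIndependent ℝ
      ![under (z i₁), fourth (z j₂) • under (z j₁) - fourth (z j₁) • under (z j₂)]) ∨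
  (∃ j₁ j₂ j₃, Submodule.span ℝ {z j₁} ≠ Submodule.span ℝ {z j₂} ∧
    Submodule.span ℝ {z j₂} ≠ Submodule.span ℝ {z j₃} ∧
    Submodule.span ℝ {z j₃} ≠ Submodule.span ℝ {z j₁} ∧
    fourth (z j₁) ≠ 0 ∧ fourth (z j₂) ≠ 0 ∧ fourth (z j₃) ≠ 0 ∧
    ¬ ∃ u : V3,
      fourth (z j₂) • under (z j₁) - fourth (z j₁) • under (z j₂) ∈ Submodule.span ℝ {u} ∧
      fourth (z j₃) • under (z j₂) - fourth (z j₂) • under (z j₃) ∈ Submodule.span ℝ {u} ∧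
      fourth (z j₁) • under (z j₃) - fourth (z j₃) • under (z j₁) ∈ Submodule.span ℝ {u})

/-- The matrix `G = ∑ᵢ kᵢ (zᵢ_×)²`. -/
noncomputable def matG (k : Fin N → ℝ) (z : Fin N → V4) : M3 :=
  ∑ i, k i • (skew (under (z i)) ^ 2)

/-- The matrix `∑ᵢ kᵢ zᵢ₄ zᵢ_×`. -/
noncomputable def matS (k : Fin N → ℝ) (z : Fin N → V4) : M3 :=
  ∑ i, (k i * fourth (z i)) • skew (under (z i))

/-- The matrix `H = S G⁻¹ S - ∑ᵢ kᵢ zᵢ₄² (I₃ - zᵢ zᵢᵀ)`. -/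
noncomputable def matH (k : Fin N → ℝ) (z : Fin N → V4) : M3 :=
  matS k z * (matG k z)⁻¹ * matS k z -
    ∑ i, (k i * fourth (z i) ^ 2) • (1 - Matrix.vecMulVec (under (z i)) (under (z i)))

/-- Local asymptotic stability in the sense of Lyapunov of the point `x` for a non-autonomous
dynamical system with state space `D`, given by its trajectories: `Traj t₀ J γ` says that `γ` is a
trajectory on the time interval `J` with initial time `t₀`. The point `x` is an equilibrium,
trajectories issued from nearby states exist for all later times, the equilibrium is stable (also
for trajectories which a priori exist on a bounded interval only), and it is locally attractive. -/
structure IsLocallyAsymptoticallyStable {S : Type*} [PseudoMetricSpace S] (D : Set S)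
    (Traj : ℝ → Set ℝ → (ℝ → S) → Prop) (x : S) : Prop where
  equilibrium : ∀ t₀ : ℝ, 0 ≤ t₀ → Traj t₀ (Ici t₀) (fun _ => x)
  complete : ∀ t₀ : ℝ, 0 ≤ t₀ → ∃ δ > 0, ∀ x₀ ∈ D, dist x₀ x < δ →
    ∃ γ, Traj t₀ (Ici t₀) γ ∧ γ t₀ = x₀
  stable : ∀ ε > 0, ∀ t₀ : ℝ, 0 ≤ t₀ → ∃ δ > 0, ∀ T > t₀, ∀ γ, Traj t₀ (Ico t₀ T) γ →
    dist (γ t₀) x < δ → ∀ t ∈ Ico t₀ T, dist (γ t) x < ε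
  attractive : ∀ t₀ : ℝ, 0 ≤ t₀ → ∃ δ > 0, ∀ γ, Traj t₀ (Ici t₀) γ →
    dist (γ t₀) x < δ → Tendsto γ atTop (𝓝 x)

end PoseObserver

/-! In the error variables the output normalization cancels and only `X` and its inverse remain as
time-dependent coefficients: Ė = E (X b̃ X⁻¹) + P(W(E)) E, while b̃ is driven by kb P((EX)ᵀ W(E)
(EX)⁻ᵀ), where W is `errorSum`. The Lyapunov function is V = ∑ kᵢ (1 - eᵢ·zᵢ) + |b̃|² / (2 kb). Its
first part has derivative -tr(Uᵀ W) along Ė = U E, the bias law is the one that cancels the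
contribution of b̃, and V̇ = -|P(W(E))|² (`hasDerivWithinAt_lyapunov`).

The geometric point is that E = 1 is an isolated zero of P(W) in SE(3) (`exists_isolated_zero`).
Writing E - 1 = U (E + 1) with U in se(3), the Cayley transform, turns tr(Uᵀ W(E)) into minus a form
quadratic in U. At E = 1 this form is positive definite because G and H are invertible, and by
compactness of the unit sphere it stays so for E near 1. Hence P(W(E)) = 0 forces U = 0. As V = 0
implies W = 0 and b̃ = 0, V is also positive definite near (1, 0).

Stability follows by trapping trajectories below the minimum of V on a small sphere
(`exists_trapping`). The same trap shows that solutions of a truncated, globally Lipschitz equation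
never meet the cut-off, which gives existence for all later times. Since V̇ does not see b̃ and the
system is non-autonomous, convergence uses Barbalat's lemma twice (`tendsto_of_solution`): on V, to
get P(W(E)) → 0 and so E → 1; then on E, whose derivative is E X b̃ X⁻¹ plus a vanishing term, to
get b̃ → 0 from the boundedness of X and X⁻¹. -/

open scoped NNReal

/-! ### Differential equations: forward existence, cut-offs, Barbalat's lemma. -/

section OrdinaryDifferentialEquations

variable {E : Type*} [NormedAddCommGroup E] [NormedSpace ℝ E]

/-- A globally Lipschitz and bounded time-dependent vector field has solutions for all later
times. -/
theorem exists_forward_solution [CompleteSpace E] {F : ℝ → E → E} {K M : ℝ≥0}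
    (lip : ∀ t, LipschitzWith K (F t)) (cont : ∀ x, Continuous fun t => F t x)
    (bdd : ∀ t x, ‖F t x‖ ≤ M) (t₀ : ℝ) (x₀ : E) :
    ∃ γ : ℝ → E, γ t₀ = x₀ ∧
      ∀ t ∈ Ici t₀, HasDerivWithinAt γ (F t (γ t)) (Ici t₀) t := by
  have local_solution (n : ℕ) : ∃ α : ℝ → E, α t₀ = x₀ ∧ ∀ t ∈ Icc t₀ (t₀ + n),
      HasDerivWithinAt α (F t (α t)) (Icc t₀ (t₀ + n)) t := by
    -- A field bounded by `M` moves a solution by at most `M * n` in time `n`, so a ball of that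
    -- radius puts no limit on the time.
    have h : IsPicardLindelof F (tmin := t₀) (tmax := t₀ + n) ⟨t₀, by simp⟩ x₀ (M * n) 0 M K :=
      { lipschitzOnWith := fun t _ => (lip t).lipschitzOnWith
        continuousOn := fun x _ => (cont x).continuousOn
        norm_le := fun t _ x _ => bdd t x
        mul_max_le := by simp }
    exact h.exists_eq_forall_mem_Icc_hasDerivWithinAt₀
  choose α hα₀ hα using local_solution
  have agree {m n : ℕ} (hmn : m ≤ n) : EqOn (α m) (α n) (Icc t₀ (t₀ + m)) := by
    have hmn' : (m : ℝ) ≤ n := by exact_mod_cast hmn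
    have right_deriv {l : ℕ} (hl : m ≤ l) (t : ℝ) (ht : t ∈ Ico t₀ (t₀ + m)) :
        HasDerivWithinAt (α l) (F t (α l t)) (Ici t) t := by
      have hl' : (m : ℝ) ≤ l := by exact_mod_cast hl
      have h := hα l t ⟨ht.1, by linarith [ht.2]⟩
      refine h.mono_of_mem_nhdsWithin ?_
      filter_upwards [self_mem_nhdsWithin,
        mem_nhdsWithin_of_mem_nhds
          (Iio_mem_nhds (lt_of_lt_of_le ht.2 (by linarith : t₀ + m ≤ t₀ + l)))] with s hs hs'
      exact ⟨ht.1.trans hs, le_of_lt hs'⟩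
    refine ODE_solution_unique lip (fun t ht => (hα m t ht).continuousWithinAt)
      (right_deriv le_rfl) (fun t ht => ?_) (right_deriv hmn) ((hα₀ m).trans (hα₀ n).symm)
    exact ((hα n t ⟨ht.1, by linarith [ht.2]⟩).continuousWithinAt).mono
      (Icc_subset_Icc_right (by linarith))
  -- The extra 1 puts `t` strictly before the end of the interval of its own local solution, which
  -- is then a neighbourhood of `t` within `Ici t₀`.
  refine ⟨fun t => α (⌈t - t₀⌉₊ + 1) t, by simpa using hα₀ _, fun t ht => ?_⟩
  have ht₀ : t₀ ≤ t := ht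
  set n := ⌈t - t₀⌉₊ + 1 with hn
  have htn : t < t₀ + n := by
    have := Nat.le_ceil (t - t₀)
    push_cast [hn]; linarith
  have hnear : Icc t₀ (t₀ + n) ∈ 𝓝[Ici t₀] t := by
    filter_upwards [self_mem_nhdsWithin, mem_nhdsWithin_of_mem_nhds (Iio_mem_nhds htn)] with s h h'
    exact ⟨h, le_of_lt h'⟩
  have h := (hα n t ⟨ht₀, htn.le⟩).mono_of_mem_nhdsWithin hnear
  refine h.congr_of_eventuallyEq ?_ rfl
  filter_upwards [hnear] with s hs
  have hsm : s ∈ Icc t₀ (t₀ + ((⌈s - t₀⌉₊ + 1 : ℕ) : ℝ)) := by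
    have := Nat.le_ceil (s - t₀)
    refine ⟨hs.1, ?_⟩
    push_cast; linarith
  rcases le_total (⌈s - t₀⌉₊ + 1) n with hle | hle
  · exact agree hle hsm
  · exact (agree hle hs).symm

/-- A vector field depending on a parameter that is `C¹` near a closed ball can be multiplied by a
cut-off function to become globally Lipschitz and bounded. -/
theorem exists_cutoff {P : Type*} [NormedAddCommGroup P] [NormedSpace ℝ P] [FiniteDimensional ℝ P]
    [FiniteDimensional ℝ E] {F : Type*} [NormedAddCommGroup F] [NormedSpace ℝ F]
    {G : P × E → F} {x₀ : E} {r R : ℝ} (hr : 0 < r) (hrR : r < R)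
    (hG : ∀ ξ, ∀ x ∈ Metric.closedBall x₀ R, ContDiffAt ℝ 1 G (ξ, x)) (C : ℝ) :
    ∃ χ : P × E → ℝ, (∀ p, 0 ≤ χ p) ∧ (∀ ξ x, ‖ξ‖ ≤ C → x ∈ Metric.closedBall x₀ r → χ (ξ, x) = 1) ∧
      (∃ K : ℝ≥0, LipschitzWith K fun p => χ p • G p) ∧
      ∃ M : ℝ≥0, ∀ p, ‖χ p • G p‖ ≤ M := by
  -- Cutting off in the parameter too makes the support compact, whence the Lipschitz and uniform
  -- bounds. The maximum with 1 keeps the inner radius positive.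
  let χ₁ : ContDiffBump (0 : P) := ⟨max C 1, max C 1 + 1, by positivity, by linarith⟩
  let χ₂ : ContDiffBump x₀ := ⟨r, R, hr, hrR⟩
  let χ : P × E → ℝ := fun p => χ₁ p.1 * χ₂ p.2
  have hχ : ContDiff ℝ 1 χ :=
    ((χ₁.contDiff (n := 1)).comp contDiff_fst).mul ((χ₂.contDiff (n := 1)).comp contDiff_snd)
  have hsupp : tsupport χ ⊆ Metric.closedBall 0 (max C 1 + 1) ×ˢ Metric.closedBall x₀ R := by
    refine closure_minimal (fun p hp => ?_) (Metric.isClosed_closedBall.prod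
      Metric.isClosed_closedBall)
    have hp' : χ₁ p.1 * χ₂ p.2 ≠ 0 := hp
    have h₁ : p.1 ∈ Function.support χ₁ := left_ne_zero_of_mul hp'
    have h₂ : p.2 ∈ Function.support χ₂ := right_ne_zero_of_mul hp'
    rw [χ₁.support_eq] at h₁
    rw [χ₂.support_eq] at h₂
    exact ⟨Metric.ball_subset_closedBall h₁, Metric.ball_subset_closedBall h₂⟩
  have hsmul : tsupport (fun p => χ p • G p) ⊆ tsupport χ :=
    closure_mono (Function.support_smul_subset_left χ G)
  have hcompact : HasCompactSupport fun p => χ p • G p :=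
    ((isCompact_closedBall _ _).prod (isCompact_closedBall _ _)).of_isClosed_subset
      (isClosed_tsupport _) (hsmul.trans hsupp)
  have hdiff : ContDiff ℝ 1 fun p => χ p • G p := by
    -- Off its support the product vanishes locally, so the smoothness of `G` is needed only over
    -- the closed ball of radius `R`.
    refine contDiff_iff_contDiffAt.2 fun p => ?_
    by_cases hp : p ∈ tsupport fun p => χ p • G p
    · exact hχ.contDiffAt.smul (hG p.1 p.2 (hsupp (hsmul hp)).2)
    · exact contDiffAt_const.congr_of_eventuallyEq (notMem_tsupport_iff_eventuallyEq.1 hp)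
  obtain ⟨M, hM⟩ := hcompact.exists_bound_of_continuous hdiff.continuous
  refine ⟨χ, fun p => mul_nonneg χ₁.nonneg χ₂.nonneg, fun ξ x hξ hx => ?_,
    hdiff.lipschitzWith_of_hasCompactSupport hcompact one_ne_zero, M.toNNReal, fun p => (hM p).trans (Real.le_coe_toNNReal M)⟩
  have h₁ : χ₁ ξ = 1 := χ₁.one_of_mem_closedBall (by simpa [χ₁] using Or.inl hξ)
  have h₂ : χ₂ x = 1 := χ₂.one_of_mem_closedBall hx
  simp [χ, h₁, h₂]

/-- A form of Barbalat's lemma: if `f` converges, and `f' = g + h` with `g` uniformly continuous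
and `h` vanishing at infinity, then `g` vanishes at infinity. -/
theorem tendsto_zero_of_hasDerivWithinAt {f g h : ℝ → E} {t₀ : ℝ} {l : E}
    (hf : ∀ t ∈ Ici t₀, HasDerivWithinAt f (g t + h t) (Ici t₀) t)
    (hg : UniformContinuousOn g (Ici t₀)) (hh : Tendsto h atTop (𝓝 0))
    (hl : Tendsto f atTop (𝓝 l)) : Tendsto g atTop (𝓝 0) := by
  rw [Metric.tendsto_nhds]
  intro ε hε
  obtain ⟨η, hη, hgη⟩ := Metric.uniformContinuousOn_iff.1 hg (ε / 4) (by positivity)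
  set s := η / 2 with hs
  have hs₀ : 0 < s := by positivity
  have hshift : Tendsto (fun t => f (t + s) - f t) atTop (𝓝 0) := by
    simpa using (hl.comp (tendsto_atTop_add_const_right atTop s tendsto_id)).sub hl
  have hsmall := (Metric.tendsto_nhds.1 hh (ε / 4) (by positivity))
  obtain ⟨T, hT⟩ := eventually_atTop.1 hsmall
  filter_upwards [Metric.tendsto_nhds.1 hshift (s * (ε / 4)) (by positivity),
    eventually_ge_atTop T, eventually_ge_atTop t₀] with t ht htT htt₀
  -- On `[t, t + s]` the derivative of `f` is within ε/4 + ε/4 of `g t`, so the increment of `f`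
  -- differs from `s • g t` by at most s ε/2. Convergence of `f` makes the increment itself smaller
  -- than s ε/4.
  have key := Convex.norm_image_sub_le_of_norm_hasDerivWithin_le (𝕜 := ℝ)
    (f := fun τ => f τ - τ • g t) (f' := fun τ => g τ + h τ - (1 : ℝ) • g t) (s := Icc t (t + s))
    (C := ε / 2) (x := t) (y := t + s)
    (fun τ hτ => ((hf τ (htt₀.trans hτ.1)).mono (fun u hu => htt₀.trans hu.1)).sub
      ((hasDerivWithinAt_id τ _).smul_const (g t)))
    (fun τ hτ => by
      have h₁ : dist (g τ) (g t) < ε / 4 := hgη τ (htt₀.trans hτ.1) t htt₀ (by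
        rw [Real.dist_eq, abs_of_nonneg (by linarith [hτ.1])]
        linarith [hτ.2])
      have h₂ : ‖h τ‖ < ε / 4 := by simpa using hT τ (htT.trans hτ.1)
      rw [dist_eq_norm] at h₁
      calc ‖g τ + h τ - (1 : ℝ) • g t‖ = ‖(g τ - g t) + h τ‖ := by rw [one_smul]; congr 1; abel
        _ ≤ ‖g τ - g t‖ + ‖h τ‖ := norm_add_le _ _
        _ ≤ ε / 2 := by linarith)
    (convex_Icc _ _) ⟨le_rfl, by linarith⟩ ⟨by linarith, le_rfl⟩
  have hnorm : s * ‖g t‖ ≤ ‖f (t + s) - f t‖ + ε / 2 * s := by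
    calc s * ‖g t‖ = ‖s • g t‖ := by rw [norm_smul, Real.norm_of_nonneg hs₀.le]
      _ = ‖(f (t + s) - f t) - (f (t + s) - (t + s) • g t - (f t - t • g t))‖ := by
        congr 1; rw [add_smul]; abel
      _ ≤ ‖f (t + s) - f t‖ + ‖f (t + s) - (t + s) • g t - (f t - t • g t)‖ := norm_sub_le _ _
      _ ≤ _ := by
        gcongr
        refine key.trans_eq ?_
        rw [add_sub_cancel_left, Real.norm_of_nonneg hs₀.le]
  rw [dist_zero_right] at ht ⊢
  have : s * ‖g t‖ < s * ε := by nlinarith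
  exact lt_of_mul_lt_mul_left this hs₀.le

/-- Heine–Cantor for `φ` on the compact set, composed with the Lipschitz curve `p`. This supplies
the uniform continuity that Barbalat's lemma asks for. -/
theorem uniformContinuousOn_comp_of_bounded_deriv {F : Type*} [PseudoMetricSpace F] {p p' : ℝ → E}
    {φ : E → F} {K : Set E} {C t₀ : ℝ} (hK : IsCompact K) (hφ : ContinuousOn φ K)
    (hp : ∀ t ∈ Ici t₀, HasDerivWithinAt p (p' t) (Ici t₀) t) (hp' : ∀ t ∈ Ici t₀, ‖p' t‖ ≤ C)
    (hpK : MapsTo p (Ici t₀) K) : UniformContinuousOn (φ ∘ p) (Ici t₀) := by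
  have hlip : LipschitzOnWith C.toNNReal p (Ici t₀) :=
    Convex.lipschitzOnWith_of_nnnorm_hasDerivWithin_le (𝕜 := ℝ) (convex_Ici _) hp fun t ht => by
      rw [← NNReal.coe_le_coe]
      exact (hp' t ht).trans (Real.le_coe_toNNReal C)
  exact (hK.uniformContinuousOn_of_continuous hφ).comp hlip.uniformContinuousOn hpK

theorem antitoneOn_of_hasDerivWithinAt {J : Set ℝ} (hJ : Convex ℝ J) {f f' : ℝ → ℝ}
    (hf : ∀ t ∈ J, HasDerivWithinAt f (f' t) J t) (hf' : ∀ t ∈ J, f' t ≤ 0) : AntitoneOn f J :=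
  antitoneOn_of_hasDerivWithinAt_nonpos hJ (fun t ht => (hf t ht).continuousWithinAt)
    (fun t ht => (hf t (interior_subset ht)).mono interior_subset)
    (fun t ht => hf' t (interior_subset ht))

theorem eq_of_hasDerivWithinAt_zero {J : Set ℝ} (hJ : Convex ℝ J) {f : ℝ → E}
    (hf : ∀ t ∈ J, HasDerivWithinAt f 0 J t) {s t : ℝ} (hs : s ∈ J) (ht : t ∈ J) : f s = f t := by
  have h := Convex.norm_image_sub_le_of_norm_hasDerivWithin_le (𝕜 := ℝ) (C := 0) hf
    (fun _ _ => by simp) hJ ht hs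
  rw [zero_mul] at h
  exact sub_eq_zero.1 (norm_le_zero_iff.1 h)

/-- A level that is never attained cannot be crossed. It serves to keep a determinant positive and
to keep trajectories inside a ball. -/
theorem lt_of_forall_ne_of_continuousOn {J : Set ℝ} (hJ : IsPreconnected J) {d : ℝ → ℝ}
    (hd : ContinuousOn d J) {c t₀ : ℝ} (ht₀ : t₀ ∈ J) (h₀ : d t₀ < c) (hne : ∀ t ∈ J, d t ≠ c) :
    ∀ t ∈ J, d t < c := by
  intro t ht
  by_contra! hlt
  obtain ⟨s, hs, hsc⟩ := hJ.intermediate_value ht₀ ht hd ⟨h₀.le, hlt⟩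
  exact hne s hs hsc

theorem AntitoneOn.exists_tendsto_atTop {f : ℝ → ℝ} {t₀ c : ℝ} (hf : AntitoneOn f (Ici t₀))
    (hc : ∀ t ∈ Ici t₀, c ≤ f t) : ∃ l, Tendsto f atTop (𝓝 l) := by
  have hanti : Antitone fun t => f (max t t₀) := fun s t hst =>
    hf (mem_Ici.2 (le_max_right _ _)) (mem_Ici.2 (le_max_right _ _)) (max_le_max_right _ hst)
  refine ⟨_, (tendsto_atTop_ciInf hanti ⟨c, ?_⟩).congr' ?_⟩
  · rintro _ ⟨t, rfl⟩
    exact hc _ (mem_Ici.2 (le_max_right _ _))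
  · filter_upwards [eventually_ge_atTop t₀] with t ht
    rw [max_eq_left ht]

end OrdinaryDifferentialEquations

theorem HasDerivWithinAt.linearMap_comp {E F : Type*} [NormedAddCommGroup E] [NormedSpace ℝ E]
    [FiniteDimensional ℝ E] [NormedAddCommGroup F] [NormedSpace ℝ F] (L : E →ₗ[ℝ] F) {f : ℝ → E}
    {f' : E} {J : Set ℝ} {t : ℝ} (hf : HasDerivWithinAt f f' J t) :
    HasDerivWithinAt (fun s => L (f s)) (L f') J t :=
  (LinearMap.toContinuousLinearMap L).hasFDerivAt.comp_hasDerivWithinAt t hf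

/-! ### The group SE(3), its Lie algebra, and their invariance under flows. -/

namespace PoseObserver

theorem mem_se3_iff {A : M4} :
    A ∈ se3 ↔ A.toBlocks₁₁ᵀ = -A.toBlocks₁₁ ∧ A.toBlocks₂₁ = 0 ∧ A.toBlocks₂₂ = 0 := by
  constructor
  · rintro ⟨w, v, rfl⟩
    refine ⟨?_, by simp, by simp⟩
    rw [Matrix.toBlocks_fromBlocks₁₁]
    ext i j
    fin_cases i <;> fin_cases j <;> simp [skew]
  · rintro ⟨h₁, h₂, h₃⟩
    refine ⟨![A (Sum.inl 2) (Sum.inl 1), A (Sum.inl 0) (Sum.inl 2), A (Sum.inl 1) (Sum.inl 0)],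
      fun i => A (Sum.inl i) (Sum.inr ()), ?_⟩
    have h (i j : Fin 3) : A (Sum.inl j) (Sum.inl i) = -A (Sum.inl i) (Sum.inl j) :=
      congrFun (congrFun h₁ i) j
    have hd (i : Fin 3) : A (Sum.inl i) (Sum.inl i) = 0 := by linarith [h i i]
    rw [← Matrix.fromBlocks_toBlocks A, h₂, h₃]
    congr 1
    ext i j
    fin_cases i <;> fin_cases j <;> simp [skew, Matrix.toBlocks₁₁, hd]
    · exact h 1 0
    · linarith [h 1 2]
    · simp [h 0 2]

/-- `se3` as a subspace. -/
def se3Submodule : Submodule ℝ M4 where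
  carrier := se3
  zero_mem' := ⟨0, 0, by ext i j; rcases i with i | i <;> rcases j with j | j <;>
    [fin_cases i <;> fin_cases j <;> simp [skew]; simp; simp; simp]⟩
  add_mem' := by
    intro A B hA hB
    rw [mem_se3_iff] at hA hB ⊢
    obtain ⟨a₁, a₂, a₃⟩ := hA
    obtain ⟨b₁, b₂, b₃⟩ := hB
    refine ⟨?_, ?_, ?_⟩
    · change (A.toBlocks₁₁ + B.toBlocks₁₁)ᵀ = -(A.toBlocks₁₁ + B.toBlocks₁₁)
      rw [Matrix.transpose_add, a₁, b₁]; abel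
    · change A.toBlocks₂₁ + B.toBlocks₂₁ = 0
      rw [a₂, b₂, add_zero]
    · change A.toBlocks₂₂ + B.toBlocks₂₂ = 0
      rw [a₃, b₃, add_zero]
  smul_mem' := by
    intro c A hA
    rw [mem_se3_iff] at hA ⊢
    obtain ⟨a₁, a₂, a₃⟩ := hA
    refine ⟨?_, ?_, ?_⟩
    · change (c • A.toBlocks₁₁)ᵀ = -(c • A.toBlocks₁₁)
      rw [Matrix.transpose_smul, a₁, smul_neg]
    · change c • A.toBlocks₂₁ = 0
      rw [a₂, smul_zero]
    · change c • A.toBlocks₂₂ = 0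
      rw [a₃, smul_zero]

/-- `proj` as a linear map. -/
noncomputable def projₗ : M4 →ₗ[ℝ] M4 where
  toFun := proj
  map_add' A B := by
    ext i j
    rcases i with i | i <;> rcases j with j | j <;>
      simp [proj, Matrix.toBlocks₁₁, Matrix.toBlocks₁₂]
    ring
  map_smul' c A := by
    ext i j
    rcases i with i | i <;> rcases j with j | j <;>
      simp [proj, Matrix.toBlocks₁₁, Matrix.toBlocks₁₂]
    ring

theorem projₗ_apply (A : M4) : projₗ A = proj A := rfl

theorem continuous_proj : Continuous proj := projₗ.continuous_of_finiteDimensional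

theorem proj_eq_self_iff {A : M4} : proj A = A ↔ A ∈ se3 := by
  refine ⟨fun h => h ▸ proj_mem_se3 A, fun h => ?_⟩
  obtain ⟨w, v, rfl⟩ := h
  ext i j
  rcases i with i | i <;> rcases j with j | j
  · fin_cases i <;> fin_cases j <;> simp [proj, skew] <;> ring
  all_goals simp [proj]

theorem isClosed_se3 : IsClosed se3 := se3Submodule.closed_of_finiteDimensional

theorem mem_SE3_iff {X : M4} :
    X ∈ SE3 ↔ X.toBlocks₁₁ᵀ * X.toBlocks₁₁ = 1 ∧ X.toBlocks₁₁.det = 1 ∧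
      X.toBlocks₂₁ = 0 ∧ X.toBlocks₂₂ = 1 := by
  constructor
  · rintro ⟨R, hR, p, rfl⟩
    rw [Matrix.mem_specialOrthogonalGroup_iff, Matrix.mem_orthogonalGroup_iff'] at hR
    simpa using hR
  · rintro ⟨h₁, h₂, h₃, h₄⟩
    refine ⟨X.toBlocks₁₁, ?_, fun i => X (Sum.inl i) (Sum.inr ()), ?_⟩
    · rw [Matrix.mem_specialOrthogonalGroup_iff, Matrix.mem_orthogonalGroup_iff']
      exact ⟨h₁, h₂⟩
    · conv_lhs => rw [← Matrix.fromBlocks_toBlocks X, h₃, h₄]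
      rfl

theorem one_mem_SE3 : (1 : M4) ∈ SE3 := by
  refine ⟨1, one_mem _, 0, ?_⟩
  rw [← Matrix.fromBlocks_one]
  rfl

theorem det_eq_one_of_mem_SE3 {X : M4} (hX : X ∈ SE3) : X.det = 1 := by
  obtain ⟨R, hR, p, rfl⟩ := hX
  rw [Matrix.mem_specialOrthogonalGroup_iff] at hR
  rw [Matrix.det_fromBlocks_zero₂₁, hR.2, Matrix.det_one, one_mul]

theorem isUnit_det_of_mem_SE3 {X : M4} (hX : X ∈ SE3) : IsUnit X.det := by
  rw [det_eq_one_of_mem_SE3 hX]; exact isUnit_one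

theorem mul_inv_of_mem_SE3 {X : M4} (hX : X ∈ SE3) : X * X⁻¹ = 1 :=
  Matrix.mul_nonsing_inv X (isUnit_det_of_mem_SE3 hX)

theorem inv_mul_of_mem_SE3 {X : M4} (hX : X ∈ SE3) : X⁻¹ * X = 1 :=
  Matrix.nonsing_inv_mul X (isUnit_det_of_mem_SE3 hX)

theorem inv_eq_adjugate_of_mem_SE3 {X : M4} (hX : X ∈ SE3) : X⁻¹ = X.adjugate := by
  rw [Matrix.inv_def, det_eq_one_of_mem_SE3 hX]
  simp

theorem mul_mem_SE3 {X Y : M4} (hX : X ∈ SE3) (hY : Y ∈ SE3) : X * Y ∈ SE3 := by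
  obtain ⟨R, hR, p, rfl⟩ := hX
  obtain ⟨Q, hQ, q, rfl⟩ := hY
  refine ⟨R * Q, mul_mem hR hQ, R *ᵥ q + p, ?_⟩
  rw [Matrix.fromBlocks_multiply]
  congr 1
  · simp
  · ext i j
    simp [Matrix.mul_apply, Matrix.mulVec, dotProduct]
  · simp
  · simp

theorem inv_mem_SE3 {X : M4} (hX : X ∈ SE3) : X⁻¹ ∈ SE3 := by
  obtain ⟨R, hR, p, rfl⟩ := hX
  have hR' := hR
  rw [Matrix.mem_specialOrthogonalGroup_iff, Matrix.mem_orthogonalGroup_iff] at hR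
  have hRt : R * Rᵀ = 1 := hR.1
  refine ⟨Rᵀ, ?_, -(Rᵀ *ᵥ p), ?_⟩
  · rw [Matrix.mem_specialOrthogonalGroup_iff, Matrix.mem_orthogonalGroup_iff']
    exact ⟨by simpa using hRt, by rw [Matrix.det_transpose, hR.2]⟩
  · refine Matrix.inv_eq_right_inv ?_
    rw [Matrix.fromBlocks_multiply, ← Matrix.fromBlocks_one]
    congr 1
    · simpa using hRt
    · have : Matrix.replicateCol Unit (-(Rᵀ *ᵥ p)) = -(Rᵀ * Matrix.replicateCol Unit p) := by
        ext i j
        simp [Matrix.mul_apply, Matrix.mulVec, dotProduct]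
      rw [this, Matrix.mul_neg, ← Matrix.mul_assoc, hRt]
      simp
    · simp
    · simp

theorem conj_mem_se3 {X A : M4} (hX : X ∈ SE3) (hA : A ∈ se3) : X * A * X⁻¹ ∈ se3 := by
  have hX' := inv_mem_SE3 hX
  have hXX := mul_inv_of_mem_SE3 hX
  obtain ⟨w, v, rfl⟩ := hA
  have hsk : (skew w)ᵀ = -skew w := by
    ext i j
    fin_cases i <;> fin_cases j <;> simp [skew]
  obtain ⟨Q, hQ, q, hY⟩ := hX'
  obtain ⟨R, hR, p, rfl⟩ := hX
  rw [hY] at hXX ⊢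
  have hRQ : R * Q = 1 := by
    have := congrArg Matrix.toBlocks₁₁ (hXX.trans Matrix.fromBlocks_one.symm)
    rw [Matrix.fromBlocks_multiply, Matrix.toBlocks_fromBlocks₁₁,
      Matrix.toBlocks_fromBlocks₁₁] at this
    simpa using this
  rw [Matrix.mem_specialOrthogonalGroup_iff, Matrix.mem_orthogonalGroup_iff] at hR
  have hQt : Q = Rᵀ := by
    have h' : R * Rᵀ = 1 := hR.1
    have h'' : Rᵀ * R = 1 := mul_eq_one_comm.1 h'
    calc Q = Rᵀ * R * Q := by rw [h'', one_mul]
      _ = Rᵀ := by rw [mul_assoc, hRQ, mul_one]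
  rw [Matrix.fromBlocks_multiply, Matrix.fromBlocks_multiply, mem_se3_iff]
  refine ⟨?_, by simp, by simp⟩
  simp [hQt, hsk, Matrix.mul_assoc]

theorem isClosed_SE3 : IsClosed SE3 := by
  have h₁₁ : Continuous fun X : M4 => X.toBlocks₁₁ :=
    continuous_id.matrix_submatrix Sum.inl Sum.inl
  have h₂₁ : Continuous fun X : M4 => X.toBlocks₂₁ :=
    continuous_id.matrix_submatrix Sum.inr Sum.inl
  have h₂₂ : Continuous fun X : M4 => X.toBlocks₂₂ :=
    continuous_id.matrix_submatrix Sum.inr Sum.inr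
  have : SE3 = {X : M4 | X.toBlocks₁₁ᵀ * X.toBlocks₁₁ = 1} ∩ ({X : M4 | X.toBlocks₁₁.det = 1} ∩
      ({X : M4 | X.toBlocks₂₁ = 0} ∩ {X : M4 | X.toBlocks₂₂ = 1})) := by
    ext X
    exact mem_SE3_iff
  rw [this]
  exact (isClosed_eq (h₁₁.matrix_transpose.matrix_mul h₁₁) continuous_const).inter
    ((isClosed_eq h₁₁.matrix_det continuous_const).inter
      ((isClosed_eq h₂₁ continuous_const).inter (isClosed_eq h₂₂ continuous_const)))

/-- A curve whose velocity is in `se3` and which starts in `se3` stays in `se3`. -/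
theorem mem_se3_of_hasDerivWithinAt {J : Set ℝ} (hJ : Convex ℝ J) {b b' : ℝ → M4}
    (hb : ∀ t ∈ J, HasDerivWithinAt b (b' t) J t) (hb' : ∀ t ∈ J, b' t ∈ se3) {t₀ : ℝ}
    (ht₀ : t₀ ∈ J) (h₀ : b t₀ ∈ se3) : ∀ t ∈ J, b t ∈ se3 := by
  intro t ht
  -- The defect `proj b - b` vanishes exactly on `se3`, and it is constant because the velocity is
  -- fixed by `proj`.
  have hderiv : ∀ s ∈ J, HasDerivWithinAt (fun s => projₗ (b s) - b s) 0 J s := fun s hs => by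
    have h := ((hb s hs).linearMap_comp projₗ).sub (hb s hs)
    rwa [projₗ_apply (b' s), proj_eq_self_iff.2 (hb' s hs), sub_self] at h
  have h := eq_of_hasDerivWithinAt_zero hJ hderiv ht ht₀
  simp only [projₗ_apply, proj_eq_self_iff.2 h₀, sub_self] at h
  exact proj_eq_self_iff.1 (sub_eq_zero.1 h)

/-- `SE3` is invariant under the left and right actions of `se3`. -/
theorem mem_SE3_of_hasDerivWithinAt {J : Set ℝ} (hJ : Convex ℝ J) {E C D : ℝ → M4}
    (hE : ∀ t ∈ J, HasDerivWithinAt E (E t * C t + D t * E t) J t) (hC : ∀ t ∈ J, C t ∈ se3)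
    (hD : ∀ t ∈ J, D t ∈ se3) {t₀ : ℝ} (ht₀ : t₀ ∈ J) (h₀ : E t₀ ∈ SE3) : ∀ t ∈ J, E t ∈ SE3 := by
  have entry (i j : I4) : ∀ t ∈ J,
      HasDerivWithinAt (fun s => E s i j) ((E t * C t + D t * E t) i j) J t := fun t ht =>
    (hE t ht).linearMap_comp (Matrix.entryLinearMap ℝ ℝ i j)
  obtain ⟨o₁, o₂, o₃, o₄⟩ := mem_SE3_iff.1 h₀
  -- The bottom row ρ evolves by ρ' = ρ Ω with Ω skew-symmetric, so |ρ|² is constant. Once ρ = 0 the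
  -- corner entry is constant too.
  have row : ∀ t ∈ J, ∀ j, E t (Sum.inr ()) (Sum.inl j) = 0 := by
    have hconst : ∀ t ∈ J, HasDerivWithinAt
        (fun s => ∑ j : Fin 3, E s (Sum.inr ()) (Sum.inl j) ^ 2) 0 J t := fun t ht => by
      have h := HasDerivWithinAt.fun_sum (u := Finset.univ) fun j (_ : j ∈ Finset.univ) =>
        (entry (Sum.inr ()) (Sum.inl j) t ht).pow 2
      refine h.congr_deriv ?_
      obtain ⟨w, v, hw⟩ := hC t ht
      obtain ⟨w', v', hw'⟩ := hD t ht
      simp [hw, hw', Matrix.mul_apply, skew, Fin.sum_univ_three]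
      ring
    intro t ht
    have h := eq_of_hasDerivWithinAt_zero hJ hconst ht ht₀
    have h0 : ∀ j, E t₀ (Sum.inr ()) (Sum.inl j) = 0 := fun j => congrFun (congrFun o₃ ()) j
    simp only [h0] at h
    have h' := (Finset.sum_eq_zero_iff_of_nonneg (fun j _ => sq_nonneg _)).1
      (h.trans (by simp))
    exact fun j => pow_eq_zero_iff two_ne_zero |>.1 (h' j (Finset.mem_univ j))
  have corner : ∀ t ∈ J, E t (Sum.inr ()) (Sum.inr ()) = 1 := by
    intro t ht
    have hconst : ∀ t ∈ J, HasDerivWithinAt (fun s => E s (Sum.inr ()) (Sum.inr ())) 0 J t :=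
      fun t ht => by
        refine (entry (Sum.inr ()) (Sum.inr ()) t ht).congr_deriv ?_
        obtain ⟨w, v, hw⟩ := hC t ht
        obtain ⟨w', v', hw'⟩ := hD t ht
        simp [hw, hw', Matrix.mul_apply, row t ht]
    rw [eq_of_hasDerivWithinAt_zero hJ hconst ht ht₀]
    exact congrFun (congrFun o₄ ()) ()
  let L : M4 →ₗ[ℝ] M3 :=
    { toFun := Matrix.toBlocks₁₁, map_add' := fun _ _ => rfl, map_smul' := fun _ _ => rfl }
  let T : M3 →ₗ[ℝ] M3 := (Matrix.transposeLinearEquiv (Fin 3) (Fin 3) ℝ ℝ).toLinearMap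
  let R : ℝ → M3 := fun t => (E t).toBlocks₁₁
  have hR : ∀ t ∈ J, HasDerivWithinAt R
      (R t * (C t).toBlocks₁₁ + (D t).toBlocks₁₁ * R t) J t := fun t ht => by
    refine ((hE t ht).linearMap_comp L).congr_deriv ?_
    have h₂₁ : (E t).toBlocks₂₁ = 0 := by ext i j; exact row t ht j
    have hC₂₁ := (mem_se3_iff.1 (hC t ht)).2.1
    have hmul (P Q : M4) : (P * Q).toBlocks₁₁ =
        P.toBlocks₁₁ * Q.toBlocks₁₁ + P.toBlocks₁₂ * Q.toBlocks₂₁ := by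
      conv_lhs => rw [← Matrix.fromBlocks_toBlocks P, ← Matrix.fromBlocks_toBlocks Q,
        Matrix.fromBlocks_multiply, Matrix.toBlocks_fromBlocks₁₁]
    change (E t * C t).toBlocks₁₁ + (D t * E t).toBlocks₁₁ = _
    rw [hmul, hmul, h₂₁, hC₂₁]
    simp [R]
  -- The left velocity drops out of (RᵀR)' by skew-symmetry, leaving the commutator equation Q' = QΩ
  -- - ΩQ. So tr Q² is constant, hence zero, and the symmetry of Q gives Q = 0.
  let Q : ℝ → M3 := fun t => (R t)ᵀ * R t - 1
  have hQ : ∀ t ∈ J, HasDerivWithinAt Q (Q t * (C t).toBlocks₁₁ - (C t).toBlocks₁₁ * Q t) J t :=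
    fun t ht => by
      have h := (((hR t ht).linearMap_comp T).mul (hR t ht)).sub_const 1
      refine h.congr_deriv ?_
      have hΩ := (mem_se3_iff.1 (hC t ht)).1
      have hΨ := (mem_se3_iff.1 (hD t ht)).1
      change (R t * (C t).toBlocks₁₁ + (D t).toBlocks₁₁ * R t)ᵀ * R t +
        (R t)ᵀ * (R t * (C t).toBlocks₁₁ + (D t).toBlocks₁₁ * R t) = _
      simp only [Q, Matrix.transpose_add, Matrix.transpose_mul, hΩ, hΨ]
      noncomm_ring
  have hQtr : ∀ t ∈ J, HasDerivWithinAt (fun s => (Q s * Q s).trace) 0 J t := fun t ht => by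
    have h := ((hQ t ht).mul (hQ t ht)).linearMap_comp (Matrix.traceLinearMap (Fin 3) ℝ ℝ)
    refine h.congr_deriv ?_
    simp only [Matrix.traceLinearMap_apply, Matrix.trace_add, sub_mul, mul_sub, Matrix.trace_sub]
    have h₁ := Matrix.trace_mul_comm (Q t * Q t) (C t).toBlocks₁₁
    simp only [mul_assoc] at h₁ ⊢
    rw [h₁]
    ring
  have hQ₀ : ∀ t ∈ J, Q t = 0 := fun t ht => by
    have h := eq_of_hasDerivWithinAt_zero hJ hQtr ht ht₀
    have h0 : Q t₀ = 0 := sub_eq_zero.2 o₁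
    have hsymm : (Q t)ᴴ = Q t := by
      simp [Q, Matrix.conjTranspose_eq_transpose_of_trivial, Matrix.transpose_mul]
    simp only [h0, mul_zero, Matrix.trace_zero] at h
    rw [← Matrix.trace_conjTranspose_mul_self_eq_zero_iff, hsymm, h]
  have hdet : ∀ t ∈ J, (R t).det ^ 2 = 1 := fun t ht => by
    have h := congrArg Matrix.det (sub_eq_zero.1 (hQ₀ t ht))
    rw [Matrix.det_mul, Matrix.det_transpose, Matrix.det_one] at h
    rw [sq, h]
  have hRcont : ContinuousOn R J := fun t ht => (hR t ht).continuousWithinAt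
  -- The determinant is ±1 and starts at 1; by continuity it cannot change sign.
  have hdetpos : ∀ t ∈ J, -(R t).det < 0 := by
    refine lt_of_forall_ne_of_continuousOn hJ.isPreconnected
      (Continuous.comp_continuousOn (continuous_id.matrix_det) hRcont).neg ht₀ ?_ fun t ht h => ?_
    · change -(E t₀).toBlocks₁₁.det < 0
      rw [o₂]; norm_num
    · have h' : -(R t).det = 0 := h
      have := hdet t ht
      rw [neg_eq_zero.1 h'] at this
      norm_num at this
  intro t ht
  refine mem_SE3_iff.2 ⟨sub_eq_zero.1 (hQ₀ t ht), ?_, ?_, ?_⟩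
  · change (R t).det = 1
    nlinarith [hdet t ht, hdetpos t ht]
  · ext i j; exact row t ht j
  · ext i j; exact corner t ht

end PoseObserver

/-! ### Calculus of curves and maps with values in matrices. -/

theorem HasDerivWithinAt.dotProduct {ι : Type*} [Fintype ι] {f g : ℝ → ι → ℝ} {f' g' : ι → ℝ}
    {J : Set ℝ} {t : ℝ} (hf : HasDerivWithinAt f f' J t) (hg : HasDerivWithinAt g g' J t) :
    HasDerivWithinAt (fun s => f s ⬝ᵥ g s) (f' ⬝ᵥ g t + f t ⬝ᵥ g') J t := by
  have h := HasDerivWithinAt.fun_sum (u := Finset.univ) fun i (_ : i ∈ Finset.univ) =>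
    (hasDerivWithinAt_pi.1 hf i).mul (hasDerivWithinAt_pi.1 hg i)
  refine h.congr_deriv ?_
  simp [_root_.dotProduct, Finset.sum_add_distrib]

theorem HasDerivWithinAt.matrix_inv {n : Type*} [Fintype n] [DecidableEq n]
    {X : ℝ → Matrix n n ℝ} {X' : Matrix n n ℝ} {J : Set ℝ} {t : ℝ}
    (hX : HasDerivWithinAt X X' J t) (hu : IsUnit (X t)) :
    HasDerivWithinAt (fun s => (X s)⁻¹) (-((X t)⁻¹ * X' * (X t)⁻¹)) J t := by
  obtain ⟨u, hu⟩ := hu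
  have h := (hu ▸ hasFDerivAt_ringInverse (𝕜 := ℝ) u : HasFDerivAt Ring.inverse _ (X t))
  have h' := h.comp_hasDerivWithinAt t hX
  simp only [Function.comp_def, ← Matrix.nonsing_inv_eq_ringInverse] at h'
  refine h'.congr_deriv ?_
  simp [← hu, Matrix.coe_units_inv]

/-- Matrices carry the Frobenius norm, not the sup norm of a function space. Smoothness is obtained
entrywise in the latter and carried over by a linear map, continuous in finite dimension. -/
theorem contDiffAt_matrix {E m n : Type*} [NormedAddCommGroup E] [NormedSpace ℝ E] [Fintype m]
    [Fintype n] {f : E → Matrix m n ℝ} {x : E} {l : WithTop ℕ∞}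
    (hf : ∀ i j, ContDiffAt ℝ l (fun y => f y i j) x) : ContDiffAt ℝ l f x := by
  have h : ContDiffAt ℝ l (fun y i j => f y i j) x :=
    contDiffAt_pi.2 fun i => contDiffAt_pi.2 fun j => hf i j
  exact (LinearMap.toContinuousLinearMap
    (Matrix.ofLinearEquiv ℝ (m := m) (n := n) (α := ℝ)).toLinearMap).contDiff.contDiffAt.comp x h

theorem ContDiffAt.linearMap_comp {E F G : Type*} [NormedAddCommGroup E] [NormedSpace ℝ E]
    [NormedAddCommGroup F] [NormedSpace ℝ F] [FiniteDimensional ℝ F] [NormedAddCommGroup G]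
    [NormedSpace ℝ G] (L : F →ₗ[ℝ] G) {f : E → F} {x : E} {l : WithTop ℕ∞}
    (hf : ContDiffAt ℝ l f x) : ContDiffAt ℝ l (fun y => L (f y)) x :=
  (LinearMap.toContinuousLinearMap L).contDiff.contDiffAt.comp x hf

theorem ContDiffAt.matrix_inv {E n : Type*} [NormedAddCommGroup E] [NormedSpace ℝ E] [Fintype n]
    [DecidableEq n] {f : E → Matrix n n ℝ} {x : E} {l : WithTop ℕ∞} (hf : ContDiffAt ℝ l f x)
    (hu : IsUnit (f x)) : ContDiffAt ℝ l (fun y => (f y)⁻¹) x := by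
  obtain ⟨u, hu⟩ := hu
  have h := (hu ▸ contDiffAt_ringInverse ℝ u : ContDiffAt ℝ l Ring.inverse (f x))
  have h' := h.comp x hf
  simpa only [Function.comp_def, ← Matrix.nonsing_inv_eq_ringInverse] using h'

theorem Matrix.mulVec_ne_zero_of_isUnit {n : Type*} [Fintype n] [DecidableEq n]
    {M : Matrix n n ℝ} (hM : IsUnit M) {v : n → ℝ} (hv : v ≠ 0) : M *ᵥ v ≠ 0 := by
  rw [← Matrix.mulVec_zero M]
  exact (Matrix.mulVec_injective_iff_isUnit.2 hM).ne hv

/-! ### The innovation and the pose cost as functions of the error. -/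

namespace PoseObserver

variable {N : ℕ}

theorem dotProduct_self_pos {x : V4} (hx : x ≠ 0) : 0 < x ⬝ᵥ x :=
  lt_of_le_of_ne (Finset.sum_nonneg fun i _ => mul_self_nonneg (x i))
    (Ne.symm (mt dotProduct_self_eq_zero.1 hx))

theorem ne_zero_of_dotProduct_self_eq_one {x : V4} (hx : x ⬝ᵥ x = 1) : x ≠ 0 := by
  rintro rfl
  simp at hx

theorem unitVector_dotProduct_self {x : V4} (hx : x ≠ 0) : unitVector x ⬝ᵥ unitVector x = 1 := by
  have h := dotProduct_self_pos hx
  have h' := Real.mul_self_sqrt h.le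
  have h'' := Real.sqrt_pos.2 h
  simp only [unitVector, smul_dotProduct, dotProduct_smul, smul_eq_mul]
  field_simp
  rw [sq, h']

theorem unitVector_smul {c : ℝ} (hc : 0 < c) (x : V4) : unitVector (c • x) = unitVector x := by
  have h : Real.sqrt ((c • x) ⬝ᵥ (c • x)) = c * Real.sqrt (x ⬝ᵥ x) := by
    rw [smul_dotProduct, dotProduct_smul, smul_eq_mul, smul_eq_mul, ← mul_assoc,
      Real.sqrt_mul (by positivity), Real.sqrt_mul_self hc.le]
  rw [unitVector, h, unitVector, smul_smul, mul_inv, mul_comm c⁻¹, mul_assoc,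
    inv_mul_cancel₀ hc.ne', mul_one]

theorem unitVector_of_dotProduct_self_eq_one {x : V4} (hx : x ⬝ᵥ x = 1) : unitVector x = x := by
  simp [unitVector, hx]

theorem sqrt_smul_unitVector {x : V4} (hx : x ≠ 0) :
    Real.sqrt (x ⬝ᵥ x) • unitVector x = x := by
  have h := Real.sqrt_pos.2 (dotProduct_self_pos hx)
  rw [unitVector, smul_smul, mul_inv_cancel₀ h.ne', one_smul]

theorem isUnit_of_mem_SE3 {X : M4} (hX : X ∈ SE3) : IsUnit X :=
  (Matrix.isUnit_iff_isUnit_det X).2 (isUnit_det_of_mem_SE3 hX)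

theorem contDiffAt_unitVector {x : V4} (hx : x ≠ 0) {l : WithTop ℕ∞} :
    ContDiffAt ℝ l unitVector x := by
  have h := dotProduct_self_pos hx
  have hdot : ContDiffAt ℝ l (fun y : V4 => y ⬝ᵥ y) x :=
    ContDiffAt.sum fun i _ => (contDiff_apply ℝ ℝ i).contDiffAt.mul (contDiff_apply ℝ ℝ i).contDiffAt
  exact ((hdot.sqrt h.ne').inv (Real.sqrt_pos.2 h).ne').smul contDiffAt_id

/-- The matrix `∑ᵢ kᵢ (I₄ - eᵢ eᵢᵀ) zᵢ eᵢᵀ` with `eᵢ = E zᵢ / |E zᵢ|`, as a function of the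
error `E`. -/
noncomputable def errorSum (k : Fin N → ℝ) (z : Fin N → V4) (E : M4) : M4 :=
  innovationSum k z E z

/-- The factor normalizing the output is positive, so it disappears when X̂ y is normalized again:
the innovation depends on X̂ and X only through E. -/
theorem innovationSum_output {z : Fin N → V4} (hz : ∀ i, z i ≠ 0) (k : Fin N → ℝ) {Xh X : M4}
    (hX : X ∈ SE3) :
    innovationSum k z Xh (fun i => output X (z i)) = errorSum k z (Xh * X⁻¹) := by
  have h (i : Fin N) : outputError Xh (output X (z i)) = outputError (Xh * X⁻¹) (z i) := by
    have hne : X⁻¹ *ᵥ z i ≠ 0 :=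
      Matrix.mulVec_ne_zero_of_isUnit (isUnit_of_mem_SE3 (inv_mem_SE3 hX)) (hz i)
    rw [outputError, output]
    nth_rewrite 2 [unitVector]
    rw [Matrix.mulVec_smul, Matrix.mulVec_mulVec,
      unitVector_smul (inv_pos.2 (Real.sqrt_pos.2 (dotProduct_self_pos hne))), outputError]
  simp only [errorSum, innovationSum, h]

/-- From tr(Uᵀ x eᵀ) = (U e)·x. Each summand is the pairing of (I - e eᵀ) U e with z, that is, the
rate of change of e·z when E moves with velocity U E. -/
theorem trace_transpose_mul_errorSum (k : Fin N → ℝ) (z : Fin N → V4) (E U : M4) :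
    (Uᵀ * errorSum k z E).trace = ∑ i, k i * ((U *ᵥ unitVector (E *ᵥ z i)) ⬝ᵥ z i -
      ((U *ᵥ unitVector (E *ᵥ z i)) ⬝ᵥ unitVector (E *ᵥ z i)) *
        (unitVector (E *ᵥ z i) ⬝ᵥ z i)) := by
  rw [errorSum, innovationSum, Finset.mul_sum, Matrix.trace_sum]
  refine Finset.sum_congr rfl fun i _ => ?_
  rw [Matrix.mul_smul, Matrix.trace_smul, smul_eq_mul, outputError]
  congr 1
  set e := unitVector (E *ᵥ z i)
  have h (x : V4) : (Uᵀ * Matrix.vecMulVec x e).trace = (U *ᵥ e) ⬝ᵥ x := by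
    rw [Matrix.mul_vecMulVec, Matrix.trace_vecMulVec, Matrix.mulVec_transpose,
      ← Matrix.dotProduct_mulVec, dotProduct_comm]
  rw [sub_mul, one_mul, mul_sub, Matrix.trace_sub, h, Matrix.vecMulVec_mul_vecMulVec,
    Matrix.vecMulVec_smul, Matrix.mul_smul, Matrix.trace_smul, h, smul_eq_mul]
  ring

theorem errorSum_one {z : Fin N → V4} (hz : ∀ i, z i ⬝ᵥ z i = 1) (k : Fin N → ℝ) :
    errorSum k z 1 = 0 := by
  rw [errorSum, innovationSum]
  refine Finset.sum_eq_zero fun i _ => ?_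
  rw [outputError, Matrix.one_mulVec, unitVector_of_dotProduct_self_eq_one (hz i), sub_mul,
    one_mul, Matrix.vecMulVec_mul_vecMulVec, hz i, one_smul, sub_self, smul_zero]

theorem contDiffAt_errorSum {z : Fin N → V4} (hz : ∀ i, z i ≠ 0) (k : Fin N → ℝ) {E : M4}
    (hE : IsUnit E) {l : WithTop ℕ∞} : ContDiffAt ℝ l (errorSum k z) E := by
  unfold errorSum innovationSum
  refine ContDiffAt.sum fun i _ => ?_
  have hlin : ContDiffAt ℝ l (fun F : M4 => F *ᵥ z i) E :=
    (contDiffAt_id (E := M4)).linearMap_comp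
      ((Matrix.mulVecBilin ℝ ℝ).flip (z i) : M4 →ₗ[ℝ] V4)
  have he : ContDiffAt ℝ l (fun F : M4 => outputError F (z i)) E :=
    (contDiffAt_unitVector (Matrix.mulVec_ne_zero_of_isUnit hE (hz i))).comp E hlin
  have he' (j : I4) : ContDiffAt ℝ l (fun F : M4 => outputError F (z i) j) E :=
    contDiffAt_pi.1 he j
  have hee : ContDiffAt ℝ l
      (fun F : M4 => Matrix.vecMulVec (outputError F (z i)) (outputError F (z i))) E :=
    contDiffAt_matrix fun a b => (he' a).mul (he' b)
  have hze : ContDiffAt ℝ l (fun F : M4 => Matrix.vecMulVec (z i) (outputError F (z i))) E :=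
    contDiffAt_matrix fun a b => contDiffAt_const.mul (he' b)
  exact ((contDiffAt_const.sub hee).mul hze).const_smul (k i)

/-- The sum `∑ᵢ kᵢ (1 - eᵢ ⬝ zᵢ)` with `eᵢ = E zᵢ / |E zᵢ|`. -/
noncomputable def poseCost (k : Fin N → ℝ) (z : Fin N → V4) (E : M4) : ℝ :=
  ∑ i, k i * (1 - unitVector (E *ᵥ z i) ⬝ᵥ z i)

theorem continuousAt_poseCost {z : Fin N → V4} (hz : ∀ i, z i ≠ 0) (k : Fin N → ℝ) {E : M4}
    (hE : IsUnit E) : ContinuousAt (poseCost k z) E := by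
  refine tendsto_finsetSum _ fun i _ => tendsto_const_nhds.mul (tendsto_const_nhds.sub ?_)
  have he : ContinuousAt (fun F : M4 => unitVector (F *ᵥ z i)) E :=
    ((contDiffAt_unitVector (l := 0)
      (Matrix.mulVec_ne_zero_of_isUnit hE (hz i))).continuousAt).comp
      (f := fun F : M4 => F *ᵥ z i)
      (Continuous.matrix_mulVec continuous_id continuous_const).continuousAt
  have hd : Continuous fun x : V4 => x ⬝ᵥ z i := continuous_id.dotProduct continuous_const
  exact hd.continuousAt.comp he

/-- The normalized vector satisfies e' = (I - e eᵀ) U e. Paired with z this gives the summands of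
`trace_transpose_mul_errorSum`. -/
theorem hasDerivWithinAt_poseCost {z : Fin N → V4} (hz : ∀ i, z i ≠ 0) (k : Fin N → ℝ)
    {E : ℝ → M4} {U : M4} {J : Set ℝ} {t : ℝ} (hu : IsUnit (E t))
    (hE : HasDerivWithinAt E (U * E t) J t) :
    HasDerivWithinAt (fun s => poseCost k z (E s)) (-(Uᵀ * errorSum k z (E t)).trace) J t := by
  rw [trace_transpose_mul_errorSum, ← Finset.sum_neg_distrib]
  refine HasDerivWithinAt.fun_sum fun i _ => ?_
  rw [← mul_neg]
  refine HasDerivWithinAt.const_mul _ ?_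
  refine HasDerivWithinAt.const_sub _ ?_
  have hne := Matrix.mulVec_ne_zero_of_isUnit hu (hz i)
  have hpos := dotProduct_self_pos hne
  have hsq := Real.sqrt_pos.2 hpos
  have hv : HasDerivWithinAt (fun s => E s *ᵥ z i) (U *ᵥ (E t *ᵥ z i)) J t :=
    (hE.linearMap_comp ((Matrix.mulVecBilin ℝ ℝ).flip (z i))).congr_deriv (by
      rw [Matrix.mulVec_mulVec]; rfl)
  have hn := ((hv.dotProduct hv).sqrt hpos.ne').inv hsq.ne'
  have h := hn.mul (hv.dotProduct (hasDerivWithinAt_const t J (z i)))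
  have hfun : (fun s => unitVector (E s *ᵥ z i) ⬝ᵥ z i) = fun s =>
      (Real.sqrt ((E s *ᵥ z i) ⬝ᵥ (E s *ᵥ z i)))⁻¹ * ((E s *ᵥ z i) ⬝ᵥ z i) := by
    funext s
    rw [unitVector, smul_dotProduct, smul_eq_mul]
  rw [hfun]
  refine h.congr_deriv ?_
  simp only [unitVector, Matrix.mulVec_smul, smul_dotProduct, dotProduct_smul, smul_eq_mul,
    dotProduct_zero, add_zero]
  rw [dotProduct_comm (E t *ᵥ z i) (U *ᵥ (E t *ᵥ z i))]
  set n := Real.sqrt ((E t *ᵥ z i) ⬝ᵥ (E t *ᵥ z i))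
  simp only [Pi.inv_apply]
  field_simp
  ring

/-- For unit vectors 1 - e·z = |e - z|²/2, so zero cost means eᵢ = zᵢ for all i, which (I - e eᵀ) z
annihilates. Thus zeros of the cost are zeros of the innovation. -/
theorem poseCost_nonneg {k : Fin N → ℝ} (hk : ∀ i, 0 < k i) {z : Fin N → V4}
    (hz : ∀ i, z i ⬝ᵥ z i = 1) {E : M4} (hE : IsUnit E) :
    0 ≤ poseCost k z E ∧ (poseCost k z E = 0 → errorSum k z E = 0) := by
  have hterm (i : Fin N) : 1 - unitVector (E *ᵥ z i) ⬝ᵥ z i =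
      (1 / 2) * ((unitVector (E *ᵥ z i) - z i) ⬝ᵥ (unitVector (E *ᵥ z i) - z i)) := by
    have h := unitVector_dotProduct_self (Matrix.mulVec_ne_zero_of_isUnit hE
      (ne_zero_of_dotProduct_self_eq_one (hz i)))
    rw [sub_dotProduct, dotProduct_sub, dotProduct_sub, h, hz i,
      dotProduct_comm (z i) (unitVector (E *ᵥ z i))]
    ring
  have hnn (i : Fin N) : 0 ≤ 1 - unitVector (E *ᵥ z i) ⬝ᵥ z i := by
    rw [hterm i]
    exact mul_nonneg (by norm_num) (Finset.sum_nonneg fun j _ => mul_self_nonneg _)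
  have hnn' (i : Fin N) : 0 ≤ k i * (1 - unitVector (E *ᵥ z i) ⬝ᵥ z i) :=
    mul_nonneg (hk i).le (hnn i)
  refine ⟨Finset.sum_nonneg fun i _ => hnn' i, fun h => ?_⟩
  have h' := (Finset.sum_eq_zero_iff_of_nonneg fun i _ => hnn' i).1 h
  rw [errorSum, innovationSum]
  refine Finset.sum_eq_zero fun i hi => ?_
  have h₁ : 1 - unitVector (E *ᵥ z i) ⬝ᵥ z i = 0 :=
    (mul_eq_zero.1 (h' i hi)).resolve_left (hk i).ne'
  rw [hterm i] at h₁
  have h₂ : unitVector (E *ᵥ z i) = z i := by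
    rw [← sub_eq_zero, ← dotProduct_self_eq_zero]
    linarith
  rw [outputError, h₂, sub_mul, one_mul, Matrix.vecMulVec_mul_vecMulVec, hz i, one_smul,
    sub_self, smul_zero]

/-! ### The identity as an isolated zero of the innovation. -/

/-- A quadratic form in `U` which, when `U` is the Cayley transform of `E`, is the opposite of the
inner product of `U` and `errorSum k z E`. -/
noncomputable def cayleyForm (k : Fin N → ℝ) (z : Fin N → V4) (E U : M4) : ℝ :=
  ∑ i, k i * ((U *ᵥ unitVector (E *ᵥ z i)) ⬝ᵥ (U *ᵥ (E *ᵥ z i + z i)) -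
    ((U *ᵥ unitVector (E *ᵥ z i)) ⬝ᵥ unitVector (E *ᵥ z i)) *
      (unitVector (E *ᵥ z i) ⬝ᵥ (U *ᵥ (E *ᵥ z i + z i))))

/-- Here z = E z - U (E z + z), and E z is a multiple of e, which I - e eᵀ kills. The remaining term
carries a second factor U. -/
theorem trace_transpose_mul_errorSum_cayley {z : Fin N → V4} (hz : ∀ i, z i ≠ 0) (k : Fin N → ℝ)
    {E U : M4} (hE : IsUnit E) (hU : E - 1 = U * (E + 1)) :
    (Uᵀ * errorSum k z E).trace = -cayleyForm k z E U := by
  rw [trace_transpose_mul_errorSum, cayleyForm, ← Finset.sum_neg_distrib]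
  refine Finset.sum_congr rfl fun i _ => ?_
  rw [← mul_neg]
  congr 1
  have hne := Matrix.mulVec_ne_zero_of_isUnit hE (hz i)
  have hzi : E *ᵥ z i - z i = U *ᵥ (E *ᵥ z i + z i) := by
    have h := congrArg (fun M : M4 => M *ᵥ z i) hU
    simpa [Matrix.sub_mulVec, Matrix.add_mulVec, ← Matrix.mulVec_mulVec] using h
  have hn := sqrt_smul_unitVector hne
  have he := unitVector_dotProduct_self hne
  rw [← hzi]
  set e := unitVector (E *ᵥ z i)
  rw [← hn]
  simp only [dotProduct_sub, dotProduct_smul, smul_eq_mul, he]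
  ring

theorem cayleyForm_smul (k : Fin N → ℝ) (z : Fin N → V4) (E U : M4) (c : ℝ) :
    cayleyForm k z E (c • U) = c ^ 2 * cayleyForm k z E U := by
  rw [cayleyForm, cayleyForm, Finset.mul_sum]
  refine Finset.sum_congr rfl fun i _ => ?_
  simp only [Matrix.smul_mulVec, smul_dotProduct, dotProduct_smul, smul_eq_mul]
  ring

theorem skew_mulVec_skew_mulVec (w v : V3) :
    skew w *ᵥ (skew v *ᵥ w) = -(skew w ^ 2 *ᵥ v) := by
  rw [sq, ← Matrix.mulVec_mulVec]
  ext i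
  fin_cases i <;> simp [skew, Matrix.mulVec, dotProduct, Fin.sum_univ_three] <;> ring

/-- The linearization at the identity is positive definite. -/
theorem cayleyForm_one_pos {k : Fin N → ℝ} (hk : ∀ i, 0 < k i) {z : Fin N → V4}
    (hz : ∀ i, z i ⬝ᵥ z i = 1) (hG : IsUnit (matG k z)) (hH : IsUnit (matH k z)) {U : M4}
    (hU : U ∈ se3) (hU₀ : U ≠ 0) : 0 < cayleyForm k z 1 U := by
  -- At E = 1 one has e = z, and the form becomes 2 ∑ kᵢ |(I - zᵢ zᵢᵀ) U zᵢ|².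
  have hterm (i : Fin N) : (U *ᵥ unitVector ((1 : M4) *ᵥ z i)) ⬝ᵥ (U *ᵥ ((1 : M4) *ᵥ z i + z i)) -
      ((U *ᵥ unitVector ((1 : M4) *ᵥ z i)) ⬝ᵥ unitVector ((1 : M4) *ᵥ z i)) *
      (unitVector ((1 : M4) *ᵥ z i) ⬝ᵥ (U *ᵥ ((1 : M4) *ᵥ z i + z i))) =
      2 * ((U *ᵥ z i - ((U *ᵥ z i) ⬝ᵥ z i) • z i) ⬝ᵥ
        (U *ᵥ z i - ((U *ᵥ z i) ⬝ᵥ z i) • z i)) := by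
    rw [Matrix.one_mulVec, unitVector_of_dotProduct_self_eq_one (hz i), Matrix.mulVec_add]
    simp only [dotProduct_sub, sub_dotProduct, dotProduct_add, dotProduct_smul, smul_dotProduct,
      smul_eq_mul, hz i, dotProduct_comm (z i) (U *ᵥ z i)]
    ring
  have hnn (i : Fin N) : 0 ≤ k i * (2 * ((U *ᵥ z i - ((U *ᵥ z i) ⬝ᵥ z i) • z i) ⬝ᵥ
        (U *ᵥ z i - ((U *ᵥ z i) ⬝ᵥ z i) • z i))) :=
    mul_nonneg (hk i).le (mul_nonneg (by norm_num) (Finset.sum_nonneg fun j _ => mul_self_nonneg _))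
  have hsum : cayleyForm k z 1 U = ∑ i, k i * (2 * ((U *ᵥ z i - ((U *ᵥ z i) ⬝ᵥ z i) • z i) ⬝ᵥ
        (U *ᵥ z i - ((U *ᵥ z i) ⬝ᵥ z i) • z i))) :=
    Finset.sum_congr rfl fun i _ => by rw [hterm i]
  rw [hsum]
  refine lt_of_le_of_ne (Finset.sum_nonneg fun i _ => hnn i) fun h => hU₀ ?_
  have hall := (Finset.sum_eq_zero_iff_of_nonneg fun i _ => hnn i).1 h.symm
  obtain ⟨w, v, rfl⟩ := hU
  set U : M4 := Matrix.fromBlocks (skew w) (Matrix.replicateCol Unit v) 0 0 with hUdef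
  have hU3 (x : V4) (j : Fin 3) :
      (U *ᵥ x) (Sum.inl j) = (skew w *ᵥ under x + fourth x • v) j := by
    simp [hUdef, Matrix.mulVec, dotProduct, under, fourth, mul_comm]
  have hU4 (x : V4) : (U *ᵥ x) (Sum.inr ()) = 0 := by
    simp [hUdef, Matrix.mulVec, dotProduct]
  have hzero (i : Fin N) : skew w *ᵥ under (z i) + fourth (z i) • v = 0 := by
    have h₁ : (U *ᵥ z i - ((U *ᵥ z i) ⬝ᵥ z i) • z i) ⬝ᵥ
        (U *ᵥ z i - ((U *ᵥ z i) ⬝ᵥ z i) • z i) = 0 := by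
      have := (mul_eq_zero.1 (hall i (Finset.mem_univ i))).resolve_left (hk i).ne'
      linarith
    rw [dotProduct_self_eq_zero, sub_eq_zero] at h₁
    set l := (U *ᵥ z i) ⬝ᵥ z i with hl
    have h₄ : l * fourth (z i) = 0 := by
      have := congrFun h₁ (Sum.inr ())
      rw [hU4] at this
      exact this.symm
    have hl' : l = fourth (z i) * (v ⬝ᵥ under (z i)) := by
      rw [hl]
      conv_lhs => rw [dotProduct, Fintype.sum_sum_type]
      simp only [hU3, hU4, Fin.sum_univ_three, fourth]
      simp [skew, dotProduct, Fin.sum_univ_three, under]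
      ring
    have hl₀ : l = 0 := by
      have : l * l = 0 := by
        nth_rewrite 2 [hl']
        rw [← mul_assoc, h₄, zero_mul]
      exact mul_self_eq_zero.1 this
    ext j
    rw [← hU3, h₁, hl₀]
    simp
  -- Apply kᵢ zᵢ_× to w × zᵢ + zᵢ₄ v = 0 and sum over i.
  have hGS : matG k z *ᵥ w = matS k z *ᵥ v := by
    have : ∑ i, k i • (skew (under (z i)) *ᵥ (skew w *ᵥ under (z i) + fourth (z i) • v)) = 0 :=
      Finset.sum_eq_zero fun i _ => by rw [hzero i, Matrix.mulVec_zero, smul_zero]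
    rw [matG, matS, Matrix.sum_mulVec, Matrix.sum_mulVec, ← sub_eq_zero, ← neg_eq_zero,
      ← Finset.sum_sub_distrib, ← Finset.sum_neg_distrib, ← this]
    refine Finset.sum_congr rfl fun i _ => ?_
    rw [Matrix.mulVec_add, skew_mulVec_skew_mulVec, Matrix.mulVec_smul, Matrix.smul_mulVec,
      Matrix.smul_mulVec, smul_add, smul_smul, smul_neg]
    abel
  have hw : w = (matG k z)⁻¹ *ᵥ (matS k z *ᵥ v) := by
    rw [← hGS, Matrix.mulVec_mulVec,
      Matrix.nonsing_inv_mul _ ((Matrix.isUnit_iff_isUnit_det _).1 hG), Matrix.one_mulVec]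
  -- Apply kᵢ zᵢ₄ (I - zᵢ zᵢᵀ) to the same relation and sum; this projector fixes w × zᵢ, and S G⁻¹
  -- S v = S w.
  have hHv : matH k z *ᵥ v = 0 := by
    have : ∑ i, (k i * fourth (z i)) • ((1 - Matrix.vecMulVec (under (z i)) (under (z i))) *ᵥ
        (skew w *ᵥ under (z i) + fourth (z i) • v)) = 0 :=
      Finset.sum_eq_zero fun i _ => by rw [hzero i, Matrix.mulVec_zero, smul_zero]
    rw [matH, Matrix.sub_mulVec, ← Matrix.mulVec_mulVec, ← Matrix.mulVec_mulVec, ← hw, matS,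
      Matrix.sum_mulVec, Matrix.sum_mulVec, ← Finset.sum_sub_distrib, ← neg_eq_zero,
      ← Finset.sum_neg_distrib, ← this]
    refine Finset.sum_congr rfl fun i _ => ?_
    have hperp : Matrix.vecMulVec (under (z i)) (under (z i)) *ᵥ (skew w *ᵥ under (z i)) = 0 := by
      ext j
      simp [skew, Matrix.mulVec, dotProduct, Fin.sum_univ_three, Matrix.vecMulVec]
      ring
    have hcomm : skew w *ᵥ under (z i) = -(skew (under (z i)) *ᵥ w) := by
      ext j
      fin_cases j <;> simp [skew, Matrix.mulVec, dotProduct, Fin.sum_univ_three] <;> ring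
    rw [Matrix.mulVec_add, Matrix.sub_mulVec _ _ (skew w *ᵥ under (z i)), hperp,
      Matrix.one_mulVec, hcomm, Matrix.smul_mulVec, Matrix.smul_mulVec, Matrix.mulVec_smul,
      sub_zero, smul_add, smul_smul, smul_neg, neg_sub, sub_eq_add_neg, add_comm, sq, mul_assoc]
  have hv₀ : v = 0 := by
    by_contra hne
    exact Matrix.mulVec_ne_zero_of_isUnit hH hne hHv
  have hw₀ : w = 0 := by rw [hw, hv₀, Matrix.mulVec_zero, Matrix.mulVec_zero]
  rw [hUdef, hv₀, hw₀]
  ext i j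
  rcases i with i | i <;> rcases j with j | j
  · fin_cases i <;> fin_cases j <;> simp [skew]
  all_goals simp

theorem continuousAt_cayleyForm {z : Fin N → V4} (hz : ∀ i, z i ≠ 0) (k : Fin N → ℝ) {E U : M4}
    (hE : IsUnit E) : ContinuousAt (fun p : M4 × M4 => cayleyForm k z p.1 p.2) (E, U) := by
  refine tendsto_finsetSum _ fun i _ => tendsto_const_nhds.mul ?_
  have hv : ContinuousAt (fun p : M4 × M4 => p.1 *ᵥ z i) (E, U) :=
    (Continuous.matrix_mulVec continuous_fst continuous_const).continuousAt
  have he : ContinuousAt (fun p : M4 × M4 => unitVector (p.1 *ᵥ z i)) (E, U) :=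
    ContinuousAt.comp (f := fun p : M4 × M4 => p.1 *ᵥ z i) (x := (E, U)) (contDiffAt_unitVector
      (l := 0) (Matrix.mulVec_ne_zero_of_isUnit hE (hz i))).continuousAt hv
  have hmul : Continuous fun q : M4 × V4 => q.1 *ᵥ q.2 :=
    Continuous.matrix_mulVec continuous_fst continuous_snd
  have hdot : Continuous fun q : V4 × V4 => q.1 ⬝ᵥ q.2 :=
    continuous_fst.dotProduct continuous_snd
  have hUe : ContinuousAt (fun p : M4 × M4 => p.2 *ᵥ unitVector (p.1 *ᵥ z i)) (E, U) :=
    hmul.continuousAt.comp (continuousAt_snd.prodMk he)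
  have hUz : ContinuousAt (fun p : M4 × M4 => p.2 *ᵥ (p.1 *ᵥ z i + z i)) (E, U) :=
    hmul.continuousAt.comp (continuousAt_snd.prodMk (hv.add continuousAt_const))
  exact (hdot.continuousAt.comp (hUe.prodMk hUz)).sub
    ((hdot.continuousAt.comp (hUe.prodMk he)).mul (hdot.continuousAt.comp (he.prodMk hUz)))

/-- The Cayley transform. -/
theorem exists_cayley {E : M4} (hE : E ∈ SE3) (hdet : (E.toBlocks₁₁ + 1).det ≠ 0) :
    ∃ U ∈ se3, E - 1 = U * (E + 1) := by
  obtain ⟨R, hR, p, rfl⟩ := hE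
  rw [Matrix.toBlocks_fromBlocks₁₁] at hdet
  rw [Matrix.mem_specialOrthogonalGroup_iff, Matrix.mem_orthogonalGroup_iff] at hR
  have hRt : R * Rᵀ = 1 := hR.1
  have hu : IsUnit (R + 1).det := isUnit_iff_ne_zero.2 hdet
  set S : M3 := (R - 1) * (R + 1)⁻¹ with hSdef
  have hS : S * (R + 1) = R - 1 := by
    rw [hSdef, mul_assoc, Matrix.nonsing_inv_mul _ hu, mul_one]
  have hSt : Sᵀ = -S := by
    -- Transpose S (R + 1) = R - 1 and multiply by R on the left.
    have h₁ : (R + 1) * Sᵀ = 1 - R := by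
      have h := congrArg (fun M : M3 => R * Mᵀ) hS
      simp only [Matrix.transpose_mul, Matrix.transpose_add, Matrix.transpose_sub,
        Matrix.transpose_one, ← mul_assoc, mul_add, mul_sub, hRt, mul_one] at h
      rw [add_comm R 1, add_mul]
      exact h
    have h₂ : (R + 1) * S = R - 1 := by
      have hcomm : (R + 1) * (R - 1) = (R - 1) * (R + 1) := by noncomm_ring
      rw [hSdef, ← mul_assoc, hcomm, mul_assoc, Matrix.mul_nonsing_inv _ hu, mul_one]
    have h₃ : (R + 1) * Sᵀ = (R + 1) * -S := by rw [h₁, mul_neg, h₂, neg_sub]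
    calc Sᵀ = (R + 1)⁻¹ * ((R + 1) * Sᵀ) := by
          rw [← mul_assoc, Matrix.nonsing_inv_mul _ hu, one_mul]
      _ = -S := by rw [h₃, ← mul_assoc, Matrix.nonsing_inv_mul _ hu, one_mul]
  let P : Matrix (Fin 3) Unit ℝ := Matrix.replicateCol Unit p
  -- The translation part q of U is forced by the equation p = S p + 2 q.
  refine ⟨Matrix.fromBlocks S ((1 / 2 : ℝ) • (P - S * P)) 0 0,
    mem_se3_iff.2 ⟨by simpa using hSt, by simp, by simp⟩, ?_⟩
  have h₁ : (Matrix.fromBlocks R P 0 1 : M4) - 1 = Matrix.fromBlocks (R - 1) P 0 0 := by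
    rw [← Matrix.fromBlocks_one, sub_eq_add_neg, Matrix.fromBlocks_neg, Matrix.fromBlocks_add]
    simp [sub_eq_add_neg]
  have h₂ : (Matrix.fromBlocks R P 0 1 : M4) + 1 = Matrix.fromBlocks (R + 1) P 0 (1 + 1) := by
    rw [← Matrix.fromBlocks_one, Matrix.fromBlocks_add]
    simp
  rw [h₁, h₂, Matrix.fromBlocks_multiply]
  congr 1
  · simp [hS]
  · rw [Matrix.mul_add, Matrix.mul_one, ← add_smul]
    norm_num
  · simp
  · simp

/-- The identity is an isolated zero in `SE3` of the innovation. -/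
theorem exists_isolated_zero {k : Fin N → ℝ} (hk : ∀ i, 0 < k i) {z : Fin N → V4}
    (hz : ∀ i, z i ⬝ᵥ z i = 1) (hG : IsUnit (matG k z)) (hH : IsUnit (matH k z)) :
    ∃ r > 0, ∀ E ∈ SE3, dist E 1 ≤ r → proj (errorSum k z E) = 0 → E = 1 := by
  have hz' (i : Fin N) := ne_zero_of_dotProduct_self_eq_one (hz i)
  have hK : IsCompact (se3 ∩ Metric.sphere 0 1) :=
    (isCompact_sphere (0 : M4) 1).inter_left isClosed_se3
  -- Positivity at E = 1 spreads to a neighbourhood common to all U in the compact unit sphere of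
  -- `se3`; homogeneity in U then covers all U ≠ 0.
  have hpos : ∀ᶠ E in 𝓝 (1 : M4), ∀ U ∈ se3 ∩ Metric.sphere 0 1, 0 < cayleyForm k z E U := by
    refine hK.eventually_forall_of_forall_eventually
      (P := fun E U => 0 < cayleyForm k z E U) fun U hU => ?_
    have hU₀ : U ≠ 0 := fun h => by simpa [h] using hU.2
    exact (continuousAt_cayleyForm hz' k isUnit_one).eventually
      (lt_mem_nhds (cayleyForm_one_pos hk hz hG hH hU.1 hU₀))
  have hdet : ∀ᶠ E in 𝓝 (1 : M4), (E.toBlocks₁₁ + 1).det ≠ 0 := by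
    have hcont : Continuous fun E : M4 => (E.toBlocks₁₁ + 1).det :=
      ((continuous_id.matrix_submatrix Sum.inl Sum.inl).add continuous_const).matrix_det
    refine hcont.continuousAt.eventually_ne ?_
    have : (1 : M4).toBlocks₁₁ + 1 = (2 : ℝ) • (1 : M3) := by
      rw [← Matrix.fromBlocks_one, Matrix.toBlocks_fromBlocks₁₁, two_smul]
    rw [this, Matrix.det_smul]
    norm_num
  obtain ⟨r, hr, hball⟩ := Metric.eventually_nhds_iff_ball.1 (hpos.and hdet)
  refine ⟨r / 2, by positivity, fun E hE hdist h₀ => ?_⟩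
  obtain ⟨hpos', hdet'⟩ := hball E (by rw [Metric.mem_ball]; linarith)
  obtain ⟨U, hU, hEU⟩ := exists_cayley hE hdet'
  -- As U lies in `se3`, tr(Uᵀ W) sees only the projection of W, which is zero.
  have hform : cayleyForm k z E U = 0 := by
    rw [← neg_eq_zero, ← trace_transpose_mul_errorSum_cayley hz' k (isUnit_of_mem_SE3 hE) hEU,
      ← trace_transpose_mul_proj U hU, h₀, Matrix.mul_zero, Matrix.trace_zero]
  have hU₀ : U = 0 := by
    by_contra hne
    have hn : ‖U‖ ≠ 0 := norm_ne_zero_iff.2 hne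
    have h := hpos' (‖U‖⁻¹ • U) ⟨se3Submodule.smul_mem _ hU, by
      rw [mem_sphere_zero_iff_norm, norm_smul, norm_inv, norm_norm, inv_mul_cancel₀ hn]⟩
    rw [cayleyForm_smul, hform, mul_zero] at h
    exact lt_irrefl _ h
  rw [hU₀, zero_mul] at hEU
  exact sub_eq_zero.1 hEU

/-! ### The error dynamics. -/

/-- The velocity of the error `(E, b̃)`, as a function of `((X, X⁻¹), (E, b̃))`. -/
noncomputable def errorField (k : Fin N → ℝ) (kb : ℝ) (z : Fin N → V4)
    (p : (M4 × M4) × (M4 × M4)) : M4 × M4 :=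
  (p.2.1 * (p.1.1 * p.2.2 * p.1.2) + proj (errorSum k z p.2.1) * p.2.1,
    kb • proj (p.1.1ᵀ * p.2.1ᵀ * errorSum k z p.2.1 * (p.2.1⁻¹)ᵀ * p.1.2ᵀ))

/-- X and X⁻¹ enter as independent variables, polynomially, so only E has to be invertible. This
permits a cut-off over arbitrary parameter values. -/
theorem contDiffAt_errorField {z : Fin N → V4} (hz : ∀ i, z i ≠ 0) (k : Fin N → ℝ) (kb : ℝ)
    {p : (M4 × M4) × (M4 × M4)} (hp : IsUnit p.2.1) {l : WithTop ℕ∞} :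
    ContDiffAt ℝ l (errorField k kb z) p := by
  let T : M4 →ₗ[ℝ] M4 := (Matrix.transposeLinearEquiv I4 I4 ℝ ℝ).toLinearMap
  have hX : ContDiffAt ℝ l (fun q : (M4 × M4) × (M4 × M4) => q.1.1) p :=
    contDiffAt_fst.fst
  have hY : ContDiffAt ℝ l (fun q : (M4 × M4) × (M4 × M4) => q.1.2) p :=
    contDiffAt_fst.snd
  have hE : ContDiffAt ℝ l (fun q : (M4 × M4) × (M4 × M4) => q.2.1) p :=
    contDiffAt_snd.fst
  have hb : ContDiffAt ℝ l (fun q : (M4 × M4) × (M4 × M4) => q.2.2) p :=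
    contDiffAt_snd.snd
  have hW : ContDiffAt ℝ l (fun q : (M4 × M4) × (M4 × M4) => errorSum k z q.2.1) p :=
    ContDiffAt.comp (g := errorSum k z) (f := fun q : (M4 × M4) × (M4 × M4) => q.2.1) p
      (contDiffAt_errorSum hz k hp) hE
  have h₁ := (hE.mul ((hX.mul hb).mul hY)).add ((hW.linearMap_comp projₗ).mul hE)
  have h₂ := ((((((hX.linearMap_comp T).mul (hE.linearMap_comp T)).mul hW).mul
    ((hE.matrix_inv hp).linearMap_comp T)).mul (hY.linearMap_comp T)).linearMap_comp
      projₗ).const_smul kb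
  exact h₁.prodMk h₂

section Trajectories

variable {k : Fin N → ℝ} {kb : ℝ} {z : Fin N → V4} {X A : ℝ → M4} {b : M4} {t₀ : ℝ} {J : Set ℝ}
  {γ : ℝ → M4 × M4}

theorem errorField_snd (k : Fin N → ℝ) (kb : ℝ) (z : Fin N → V4) (X E B : M4) :
    (errorField k kb z ((X, X⁻¹), (E, B))).2 =
      kb • proj ((E * X)ᵀ * errorSum k z E * ((E * X)ᵀ)⁻¹) := by
  simp only [errorField, Matrix.transpose_mul, Matrix.mul_inv_rev, Matrix.transpose_nonsing_inv,
    Matrix.mul_assoc]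

/-- The term X̂ A X⁻¹ coming from X̂ cancels the one coming from X⁻¹, leaving X̂ b̃ X⁻¹ = E (X b̃
X⁻¹). Membership is known only at the initial time and propagates by invariance. -/
theorem IsErrorTrajectory.mem_and_hasDerivWithinAt (hz : ∀ i, z i ≠ 0)
    (hXmem : ∀ t, 0 ≤ t → X t ∈ SE3) (hAmem : ∀ t, 0 ≤ t → A t ∈ se3)
    (hX : ∀ t, 0 ≤ t → HasDerivWithinAt X (X t * A t) (Ici 0) t) (hb : b ∈ se3)
    (hJ : Convex ℝ J) (hJ₀ : J ⊆ Ici 0) (ht₀ : t₀ ∈ J)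
    (hγ : IsErrorTrajectory k kb z X A b t₀ J γ) :
    ∀ t ∈ J, γ t ∈ SE3 ×ˢ se3 ∧
      HasDerivWithinAt γ (errorField k kb z ((X t, (X t)⁻¹), γ t)) J t := by
  obtain ⟨Xh, bh, hsol, hγeq⟩ := hγ
  have hbh : ∀ t ∈ J, bh t ∈ se3 :=
    mem_se3_of_hasDerivWithinAt hJ hsol.bias
      (fun t _ => se3Submodule.neg_mem (se3Submodule.smul_mem _ (proj_mem_se3 _))) ht₀
      hsol.init_bias
  have hXh : ∀ t ∈ J, Xh t ∈ SE3 :=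
    mem_SE3_of_hasDerivWithinAt hJ (C := fun t => A t + b - bh t)
      (D := fun t => -innovation k z (Xh t) (fun i => output (X t) (z i)))
      (fun t ht => (hsol.pose t ht).congr_deriv (by rw [sub_eq_add_neg, neg_mul]))
      (fun t ht => se3Submodule.sub_mem (se3Submodule.add_mem (hAmem t (hJ₀ ht)) hb) (hbh t ht))
      (fun t ht => by rw [innovation, neg_neg]; exact proj_mem_se3 _) ht₀ hsol.init_pose
  intro t ht
  have hXt := hXmem t (hJ₀ ht)
  refine ⟨?_, ?_⟩
  · rw [hγeq t ht]
    exact ⟨mul_mem_SE3 (hXh t ht) (inv_mem_SE3 hXt), se3Submodule.sub_mem hb (hbh t ht)⟩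
  · have hinv := ((hX t (hJ₀ ht)).mono hJ₀).matrix_inv (isUnit_of_mem_SE3 hXt)
    have h := ((hsol.pose t ht).mul hinv).prodMk ((hsol.bias t ht).const_sub b)
    refine (h.congr (fun s hs => hγeq s hs) (hγeq t ht)).congr_deriv ?_
    have hE : Xh t * (X t)⁻¹ * X t = Xh t := by
      rw [mul_assoc, inv_mul_of_mem_SE3 hXt, mul_one]
    rw [hγeq t ht]
    refine Prod.ext ?_ ?_
    · simp only [errorField, innovation, innovationSum_output hz k hXt]
      rw [← mul_assoc (X t)⁻¹ (X t) (A t), inv_mul_of_mem_SE3 hXt, one_mul,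
        ← mul_assoc (Xh t * (X t)⁻¹), ← mul_assoc (Xh t * (X t)⁻¹), hE]
      noncomm_ring
    · rw [errorField_snd, hE, innovationSum_output hz k hXt, neg_neg]

/-- The observer is recovered as X̂ = E X and b̂ = b - b̃, so existence and equilibrium can be
studied on the closed error equation. -/
theorem isErrorTrajectory_of_hasDerivWithinAt (hz : ∀ i, z i ≠ 0)
    (hXmem : ∀ t, 0 ≤ t → X t ∈ SE3)
    (hX : ∀ t, 0 ≤ t → HasDerivWithinAt X (X t * A t) (Ici 0) t) (hb : b ∈ se3)
    (hJ₀ : J ⊆ Ici 0) (ht₀ : t₀ ∈ J) (hγ₀ : γ t₀ ∈ SE3 ×ˢ se3)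
    (hγ : ∀ t ∈ J, HasDerivWithinAt γ (errorField k kb z ((X t, (X t)⁻¹), γ t)) J t) :
    IsErrorTrajectory k kb z X A b t₀ J γ := by
  have hcancel {t : ℝ} (ht : t ∈ J) : (γ t).1 * X t * (X t)⁻¹ = (γ t).1 := by
    rw [mul_assoc, mul_inv_of_mem_SE3 (hXmem t (hJ₀ ht)), mul_one]
  refine ⟨fun t => (γ t).1 * X t, fun t => b - (γ t).2,
    ⟨mul_mem_SE3 hγ₀.1 (hXmem _ (hJ₀ ht₀)), se3Submodule.sub_mem hb hγ₀.2, fun t ht => ?_,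
      fun t ht => ?_⟩, fun t ht => ?_⟩
  · have hXt := hXmem t (hJ₀ ht)
    have h := (hγ t ht).linearMap_comp (LinearMap.fst ℝ M4 M4)
    refine (h.mul ((hX t (hJ₀ ht)).mono hJ₀)).congr_deriv ?_
    simp only [LinearMap.fst_apply, errorField, innovation, innovationSum_output hz k hXt,
      hcancel ht]
    have hXX : (X t)⁻¹ * X t = 1 := inv_mul_of_mem_SE3 hXt
    have hassoc : (γ t).1 * (X t * (γ t).2 * (X t)⁻¹) * X t = (γ t).1 * X t * (γ t).2 := by
      rw [mul_assoc (γ t).1, mul_assoc (X t * (γ t).2), hXX, mul_one, mul_assoc]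
    rw [add_mul, hassoc]
    noncomm_ring
  · have hXt := hXmem t (hJ₀ ht)
    have h := (hγ t ht).linearMap_comp (LinearMap.snd ℝ M4 M4)
    refine (h.const_sub b).congr_deriv ?_
    rw [LinearMap.snd_apply, innovationSum_output hz k hXt, hcancel ht]
    exact congrArg Neg.neg (errorField_snd k kb z (X t) (γ t).1 (γ t).2)
  · simp only [hcancel ht, sub_sub_cancel]

/-! ### The Lyapunov function and its decrease. -/

/-- The Lyapunov function. -/
noncomputable def lyapunov (k : Fin N → ℝ) (kb : ℝ) (z : Fin N → V4) (x : M4 × M4) : ℝ :=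
  poseCost k z x.1 + (2 * kb)⁻¹ * (x.2ᵀ * x.2).trace

/-- The rate of decrease of the Lyapunov function. -/
noncomputable def dissipation (k : Fin N → ℝ) (z : Fin N → V4) (E : M4) : ℝ :=
  ((proj (errorSum k z E))ᵀ * proj (errorSum k z E)).trace

theorem trace_transpose_mul_self_nonneg (M : M4) : 0 ≤ (Mᵀ * M).trace := by
  simp only [Matrix.trace, Matrix.diag_apply, Matrix.mul_apply, Matrix.transpose_apply]
  exact Finset.sum_nonneg fun i _ => Finset.sum_nonneg fun j _ => mul_self_nonneg _

theorem eq_zero_of_trace_transpose_mul_self {M : M4} (h : (Mᵀ * M).trace = 0) : M = 0 := by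
  rwa [← Matrix.conjTranspose_eq_transpose_of_trivial,
    Matrix.trace_conjTranspose_mul_self_eq_zero_iff] at h

/-- With U₁ = (EY) b̃ (EY)⁻¹, the pose cost contributes -tr(U₁ᵀ W) and the bias term +tr(U₁ᵀ W).
What is left is -tr(P(W)ᵀ W) = -|P(W)|². -/
theorem hasDerivWithinAt_lyapunov (hkb : 0 < kb) (hz : ∀ i, z i ≠ 0) {t c : ℝ} {Y : M4}
    (hY : Y ∈ SE3) (hγt : γ t ∈ SE3 ×ˢ se3)
    (hγ : HasDerivWithinAt γ (c • errorField k kb z ((Y, Y⁻¹), γ t)) J t) :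
    HasDerivWithinAt (fun s => lyapunov k kb z (γ s)) (c * -dissipation k z (γ t).1) J t := by
  obtain ⟨hEm, hbm⟩ := hγt
  set E := (γ t).1 with hEdef
  set B := (γ t).2 with hBdef
  have hEE : E⁻¹ * E = 1 := inv_mul_of_mem_SE3 hEm
  have hEY := mul_mem_SE3 hEm hY
  set U₁ : M4 := E * Y * B * (E * Y)⁻¹ with hU₁
  have hU₁E : U₁ * E = E * (Y * B * Y⁻¹) := by
    rw [hU₁, Matrix.mul_inv_rev, mul_assoc (E * Y * B), mul_assoc Y⁻¹, hEE, mul_one]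
    simp only [mul_assoc]
  have h₁ : HasDerivWithinAt (fun s => (γ s).1) ((c • (U₁ + proj (errorSum k z E))) * (γ t).1) J t := by
    refine (hγ.linearMap_comp (LinearMap.fst ℝ M4 M4)).congr_deriv ?_
    rw [← hEdef, smul_mul_assoc, add_mul, hU₁E]
    rfl
  have h₂ : HasDerivWithinAt (fun s => (γ s).2)
      (c • kb • proj ((E * Y)ᵀ * errorSum k z E * ((E * Y)ᵀ)⁻¹)) J t :=
    (hγ.linearMap_comp (LinearMap.snd ℝ M4 M4)).congr_deriv
      (congrArg (c • ·) (errorField_snd k kb z Y E B))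
  let T : M4 →ₗ[ℝ] M4 := (Matrix.transposeLinearEquiv I4 I4 ℝ ℝ).toLinearMap
  have hV₁ := hasDerivWithinAt_poseCost hz k (isUnit_of_mem_SE3 hEm) h₁
  have hV₂ := (((h₂.linearMap_comp T).mul h₂).linearMap_comp
    (Matrix.traceLinearMap I4 ℝ ℝ)).const_mul ((2 * kb)⁻¹)
  refine (hV₁.add hV₂).congr_deriv ?_
  set W := errorSum k z E with hW
  set D := c • kb • proj ((E * Y)ᵀ * W * ((E * Y)ᵀ)⁻¹) with hD
  change -((c • (U₁ + proj W))ᵀ * W).trace + (2 * kb)⁻¹ * (Dᵀ * B + Bᵀ * D).trace =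
    c * -((proj W)ᵀ * proj W).trace
  have hDB : (Dᵀ * B).trace = (Bᵀ * D).trace := by
    rw [← Matrix.trace_transpose, Matrix.transpose_mul, Matrix.transpose_transpose]
  -- The projection can be dropped against `B` in `se3`; cyclicity of the trace then moves the
  -- conjugation onto `B`.
  have hBD : (Bᵀ * D).trace = c * (kb * (U₁ᵀ * W).trace) := by
    rw [hD, Matrix.mul_smul, Matrix.mul_smul, Matrix.trace_smul, Matrix.trace_smul, smul_eq_mul,
      smul_eq_mul, trace_transpose_mul_proj B hbm, hU₁,
      Matrix.transpose_mul (E * Y * B), Matrix.transpose_mul (E * Y) B,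
      ← Matrix.transpose_nonsing_inv]
    congr 2
    rw [mul_assoc ((E * Y)⁻¹)ᵀ, Matrix.trace_mul_comm ((E * Y)⁻¹)ᵀ]
    simp only [mul_assoc]
  rw [Matrix.trace_add, hDB, hBD, Matrix.transpose_smul, smul_mul_assoc, Matrix.trace_smul,
    smul_eq_mul, Matrix.transpose_add, add_mul, Matrix.trace_add,
    ← trace_transpose_mul_proj (proj W) (proj_mem_se3 W) W]
  field_simp
  ring

theorem continuousAt_lyapunov (hz : ∀ i, z i ≠ 0) {x : M4 × M4} (hx : IsUnit x.1) :
    ContinuousAt (lyapunov k kb z) x := by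
  have h₁ : ContinuousAt (fun y : M4 × M4 => poseCost k z y.1) x :=
    ContinuousAt.comp (f := fun y : M4 × M4 => y.1) (continuousAt_poseCost hz k hx) continuousAt_fst
  have h₂ : Continuous fun y : M4 × M4 => (y.2ᵀ * y.2).trace :=
    (continuous_snd.matrix_transpose.matrix_mul continuous_snd).matrix_trace
  exact h₁.add (continuousAt_const.mul h₂.continuousAt)

theorem continuousAt_dissipation (hz : ∀ i, z i ≠ 0) {E : M4} (hE : IsUnit E) :
    ContinuousAt (dissipation k z) E := by
  have h₁ : ContinuousAt (errorSum k z) E := (contDiffAt_errorSum hz k hE (l := 0)).continuousAt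
  have h₂ : Continuous fun M : M4 => ((proj M)ᵀ * proj M).trace :=
    (continuous_proj.matrix_transpose.matrix_mul continuous_proj).matrix_trace
  exact h₂.continuousAt.comp h₁

end Trajectories

variable {k : Fin N → ℝ} {kb : ℝ} {z : Fin N → V4}

theorem lyapunov_nonneg (hk : ∀ i, 0 < k i) (hkb : 0 < kb) (hz : ∀ i, z i ⬝ᵥ z i = 1)
    {x : M4 × M4} (hx : IsUnit x.1) : 0 ≤ lyapunov k kb z x :=
  add_nonneg (poseCost_nonneg hk hz hx).1
    (mul_nonneg (by positivity) (trace_transpose_mul_self_nonneg _))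

theorem lyapunov_one_zero (hz : ∀ i, z i ⬝ᵥ z i = 1) : lyapunov k kb z (1, 0) = 0 := by
  simp [lyapunov, poseCost, unitVector_of_dotProduct_self_eq_one, hz]

theorem eq_of_lyapunov_eq_zero (hk : ∀ i, 0 < k i) (hkb : 0 < kb) (hz : ∀ i, z i ⬝ᵥ z i = 1)
    {r : ℝ} (hr : ∀ E ∈ SE3, dist E 1 ≤ r → proj (errorSum k z E) = 0 → E = 1)
    {x : M4 × M4} (hx : x.1 ∈ SE3) (hxr : dist x (1, 0) ≤ r) (h : lyapunov k kb z x = 0) :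
    x = (1, 0) := by
  obtain ⟨h₁, h₂⟩ := poseCost_nonneg hk hz (isUnit_of_mem_SE3 hx)
  have h₃ := trace_transpose_mul_self_nonneg x.2
  have h₄ : 0 < (2 * kb)⁻¹ := by positivity
  have h₅ := mul_nonneg h₄.le h₃
  rw [lyapunov] at h
  refine Prod.ext (hr _ hx ((le_max_left _ _).trans hxr) ?_) ?_
  · rw [h₂ (by linarith)]
    exact projₗ.map_zero
  · refine eq_zero_of_trace_transpose_mul_self ((mul_eq_zero.1 ?_).resolve_left h₄.ne')
    linarith

/-! ### Trapping, global existence and convergence. -/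

/-- The sublevel sets of the Lyapunov function trap the solutions. The factor `c` allows for
solutions of a truncated equation. -/
theorem exists_trapping (hk : ∀ i, 0 < k i) (hkb : 0 < kb) (hz : ∀ i, z i ⬝ᵥ z i = 1)
    {r ε : ℝ} (hr : ∀ E ∈ SE3, dist E 1 ≤ r → proj (errorSum k z E) = 0 → E = 1) (hε : 0 < ε)
    (hεr : ε ≤ r) :
    ∃ δ > 0, ∀ (J : Set ℝ) (t₀ : ℝ) (γ : ℝ → M4 × M4) (X : ℝ → M4) (c : ℝ → ℝ),
      Convex ℝ J → t₀ ∈ J → J ⊆ Ici t₀ → (∀ t ∈ J, 0 ≤ c t) → (∀ t ∈ J, X t ∈ SE3) →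
      (∀ t ∈ J, γ t ∈ SE3 ×ˢ se3) →
      (∀ t ∈ J, HasDerivWithinAt γ (c t • errorField k kb z ((X t, (X t)⁻¹), γ t)) J t) →
      dist (γ t₀) (1, 0) < δ → ∀ t ∈ J, dist (γ t) (1, 0) < ε := by
  have hz' (i : Fin N) := ne_zero_of_dotProduct_self_eq_one (hz i)
  have hK : IsCompact ((SE3 ×ˢ se3) ∩ Metric.sphere ((1, 0) : M4 × M4) ε) :=
    (isCompact_sphere _ _).inter_left (isClosed_SE3.prod isClosed_se3)
  -- V has a positive lower bound `m` on the sphere of radius ε. A trajectory starting with V < m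
  -- never reaches that sphere, since V decreases.
  obtain ⟨m, hm, hKm⟩ := hK.exists_forall_le' (f := lyapunov k kb z) (a := 0)
    (fun x hx => (continuousAt_lyapunov hz' (isUnit_of_mem_SE3 hx.1.1)).continuousWithinAt)
    (fun x hx => by
      refine lt_of_le_of_ne (lyapunov_nonneg hk hkb hz (isUnit_of_mem_SE3 hx.1.1)) fun h => ?_
      have hx' : dist x (1, 0) = ε := hx.2
      have := eq_of_lyapunov_eq_zero hk hkb hz hr hx.1.1 (hx'.trans_le hεr) h.symm
      rw [this, dist_self] at hx'
      exact hε.ne hx')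
  have hsmall : ∀ᶠ x in 𝓝 ((1, 0) : M4 × M4), lyapunov k kb z x < m :=
    (continuousAt_lyapunov hz' isUnit_one).eventually
      (gt_mem_nhds (by rw [lyapunov_one_zero hz]; exact hm))
  obtain ⟨δ, hδ, hball⟩ := Metric.eventually_nhds_iff_ball.1 hsmall
  refine ⟨min δ ε, lt_min hδ hε, fun J t₀ γ X c hJ ht₀ hJt₀ hc hX hmem hγ h₀ => ?_⟩
  have hcont : ContinuousOn (fun t => dist (γ t) (1, 0)) J := fun t ht =>
    (hγ t ht).continuousWithinAt.dist continuousWithinAt_const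
  have hanti : AntitoneOn (fun t => lyapunov k kb z (γ t)) J :=
    antitoneOn_of_hasDerivWithinAt hJ
      (fun t ht => hasDerivWithinAt_lyapunov hkb hz' (hX t ht) (hmem t ht) (hγ t ht))
      (fun t ht => mul_nonpos_of_nonneg_of_nonpos (hc t ht)
        (neg_nonpos.2 (trace_transpose_mul_self_nonneg _)))
  exact lt_of_forall_ne_of_continuousOn hJ.isPreconnected hcont ht₀
    (h₀.trans_le (min_le_right _ _)) fun t ht h => absurd (hKm _ ⟨hmem t ht, h⟩) (not_le.2
      ((hanti ht₀ ht (hJt₀ ht)).trans_lt (hball _ (h₀.trans_le (min_le_left _ _)))))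

theorem continuousOn_inv_SE3 : ContinuousOn (fun X : M4 => X⁻¹) SE3 :=
  (Continuous.matrix_adjugate continuous_id).continuousOn.congr fun _ hX =>
    inv_eq_adjugate_of_mem_SE3 hX

/-- X stays in a compact part of SE(3), where inversion is continuous because it is the adjugate. -/
theorem exists_bound_inv {X : ℝ → M4} (hXmem : ∀ t, 0 ≤ t → X t ∈ SE3)
    (hXbdd : ∃ C : ℝ, ∀ t, 0 ≤ t → ‖X t‖ ≤ C) :
    ∃ C : ℝ, ∀ t, 0 ≤ t → ‖X t‖ ≤ C ∧ ‖(X t)⁻¹‖ ≤ C := by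
  obtain ⟨C, hC⟩ := hXbdd
  have hK : IsCompact (SE3 ∩ Metric.closedBall 0 C) :=
    (isCompact_closedBall _ _).inter_left isClosed_SE3
  obtain ⟨C', hC'⟩ := hK.exists_bound_of_continuousOn
    (continuousOn_inv_SE3.mono inter_subset_left)
  exact ⟨max C C', fun t ht => ⟨(hC t ht).trans (le_max_left _ _),
    (hC' _ ⟨hXmem t ht, by simpa using hC t ht⟩).trans (le_max_right _ _)⟩⟩

/-- Solutions of the error dynamics issued from states near the equilibrium exist for all later
times. -/
theorem exists_global_solution (hk : ∀ i, 0 < k i) (hkb : 0 < kb) (hz : ∀ i, z i ⬝ᵥ z i = 1)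
    {r : ℝ} (hr₀ : 0 < r) (hr : ∀ E ∈ SE3, dist E 1 ≤ r → proj (errorSum k z E) = 0 → E = 1)
    {X : ℝ → M4} (hXmem : ∀ t, 0 ≤ t → X t ∈ SE3) (hXcont : ContinuousOn X (Ici 0))
    (hXbdd : ∃ C : ℝ, ∀ t, 0 ≤ t → ‖X t‖ ≤ C) {t₀ : ℝ} (ht₀ : 0 ≤ t₀) :
    ∃ δ > 0, ∀ x₀ ∈ SE3 ×ˢ se3, dist x₀ (1, 0) < δ → ∃ γ : ℝ → M4 × M4, γ t₀ = x₀ ∧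
      ∀ t ∈ Ici t₀, HasDerivWithinAt γ (errorField k kb z ((X t, (X t)⁻¹), γ t)) (Ici t₀) t := by
  have hz' (i : Fin N) := ne_zero_of_dotProduct_self_eq_one (hz i)
  have hunit : ∀ᶠ x in 𝓝 ((1, 0) : M4 × M4), IsUnit x.1 :=
    (Units.isOpen.preimage (continuous_fst (X := M4) (Y := M4))).mem_nhds isUnit_one
  obtain ⟨R, hR, hball⟩ := Metric.nhds_basis_closedBall.eventually_iff.1 hunit
  obtain ⟨C, hC⟩ := exists_bound_inv hXmem hXbdd
  set ε := min r (R / 2) with hεdef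
  have hε : 0 < ε := lt_min hr₀ (by positivity)
  have hεR : ε < R := (min_le_right _ _).trans_lt (by linarith)
  obtain ⟨δ, hδ, htrap⟩ := exists_trapping hk hkb hz hr hε (min_le_left _ _)
  obtain ⟨χ, hχ₀, hχ₁, ⟨K, hK⟩, M, hM⟩ := exists_cutoff (P := M4 × M4) hε hεR
    (fun ξ x hx => contDiffAt_errorField hz' k kb (p := (ξ, x)) (hball hx)) C
  refine ⟨δ, hδ, fun x₀ hx₀ hdist => ?_⟩
  -- Freezing X at its value at time 0 for negative times makes the coefficients continuous on all
  -- of ℝ.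
  let ξ : ℝ → M4 × M4 := fun t => (X (max t 0), (X (max t 0))⁻¹)
  have hmaps (t : ℝ) : X (max t 0) ∈ SE3 := hXmem _ (le_max_right _ _)
  have hξcont : Continuous ξ := by
    have hX : Continuous fun t => X (max t 0) :=
      hXcont.comp_continuous (continuous_id.max continuous_const) fun t =>
        mem_Ici.2 (le_max_right _ _)
    exact hX.prodMk (continuousOn_inv_SE3.comp_continuous hX hmaps)
  obtain ⟨γ, hγ₀, hγ⟩ := exists_forward_solution
    (F := fun t x => χ (ξ t, x) • errorField k kb z (ξ t, x)) (K := K) (M := M)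
    (fun t => by simpa [Function.comp_def] using hK.comp (LipschitzWith.prodMk_left (ξ t)))
    (fun x => hK.continuous.comp (hξcont.prodMk continuous_const)) (fun t x => hM _) t₀ x₀
  have hξ : ∀ t ∈ Ici t₀, ξ t = (X t, (X t)⁻¹) := fun t ht => by
    simp only [ξ, max_eq_left (ht₀.trans ht)]
  have hγ' : ∀ t ∈ Ici t₀, HasDerivWithinAt γ
      (χ (ξ t, γ t) • errorField k kb z ((X t, (X t)⁻¹), γ t)) (Ici t₀) t := fun t ht => by
    have h := hγ t ht
    rwa [hξ t ht] at h ⊢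
  have hb : ∀ t ∈ Ici t₀, (γ t).2 ∈ se3 :=
    mem_se3_of_hasDerivWithinAt (convex_Ici t₀)
      (fun t ht => (hγ' t ht).linearMap_comp (LinearMap.snd ℝ M4 M4))
      (fun t _ => se3Submodule.smul_mem _ (se3Submodule.smul_mem _ (proj_mem_se3 _)))
      self_mem_Ici (by rw [hγ₀]; exact hx₀.2)
  -- The scalar cut-off is absorbed into the left and right velocities, so truncation preserves the
  -- invariance of SE(3).
  have hE : ∀ t ∈ Ici t₀, (γ t).1 ∈ SE3 :=
    mem_SE3_of_hasDerivWithinAt (convex_Ici t₀) (E := fun t => (γ t).1)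
      (C := fun t => χ (ξ t, γ t) • (X t * (γ t).2 * (X t)⁻¹))
      (D := fun t => χ (ξ t, γ t) • proj (errorSum k z (γ t).1))
      (fun t ht => ((hγ' t ht).linearMap_comp (LinearMap.fst ℝ M4 M4)).congr_deriv (by
        rw [Matrix.mul_smul, Matrix.smul_mul, ← smul_add]
        rfl))
      (fun t ht => se3Submodule.smul_mem _ (conj_mem_se3 (hXmem t (ht₀.trans ht)) (hb t ht)))
      (fun t _ => se3Submodule.smul_mem _ (proj_mem_se3 _))
      self_mem_Ici (by rw [hγ₀]; exact hx₀.1)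
  have hstay := htrap (Ici t₀) t₀ γ X (fun t => χ (ξ t, γ t)) (convex_Ici t₀) self_mem_Ici
    subset_rfl (fun t _ => hχ₀ _) (fun t ht => hXmem t (ht₀.trans ht))
    (fun t ht => ⟨hE t ht, hb t ht⟩) hγ' (by rwa [hγ₀])
  refine ⟨γ, hγ₀, fun t ht => (hγ' t ht).congr_deriv ?_⟩
  have hCt := hC t (ht₀.trans ht)
  rw [hχ₁ _ _ (by rw [hξ t ht]; exact max_le hCt.1 hCt.2) (hstay t ht).le, one_smul]

/-- Bounded solutions of the error dynamics which stay where the identity is the only zero of the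
innovation converge to the equilibrium. -/
theorem tendsto_of_solution (hk : ∀ i, 0 < k i) (hkb : 0 < kb) (hz : ∀ i, z i ⬝ᵥ z i = 1)
    {r : ℝ} (hr : ∀ E ∈ SE3, dist E 1 ≤ r → proj (errorSum k z E) = 0 → E = 1)
    {X A : ℝ → M4} (hXmem : ∀ t, 0 ≤ t → X t ∈ SE3)
    (hX : ∀ t, 0 ≤ t → HasDerivWithinAt X (X t * A t) (Ici 0) t)
    (hAbdd : ∃ C : ℝ, ∀ t, 0 ≤ t → ‖A t‖ ≤ C) (hXbdd : ∃ C : ℝ, ∀ t, 0 ≤ t → ‖X t‖ ≤ C)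
    {t₀ : ℝ} (ht₀ : 0 ≤ t₀) {γ : ℝ → M4 × M4} (hmem : ∀ t ∈ Ici t₀, γ t ∈ SE3 ×ˢ se3)
    (hγ : ∀ t ∈ Ici t₀,
      HasDerivWithinAt γ (errorField k kb z ((X t, (X t)⁻¹), γ t)) (Ici t₀) t)
    (hstay : ∀ t ∈ Ici t₀, dist (γ t) (1, 0) < r) : Tendsto γ atTop (𝓝 (1, 0)) := by
  have hz' (i : Fin N) := ne_zero_of_dotProduct_self_eq_one (hz i)
  obtain ⟨CA, hCA⟩ := hAbdd
  obtain ⟨C, hC⟩ := exists_bound_inv hXmem hXbdd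
  have hXSE : ∀ t ∈ Ici t₀, X t ∈ SE3 := fun t ht => hXmem t (ht₀.trans ht)
  have hC₀ : 0 ≤ C := (norm_nonneg _).trans (hC 0 le_rfl).1
  let p : ℝ → (M4 × M4) × (M4 × M4) := fun t => ((X t, (X t)⁻¹), γ t)
  let K : Set ((M4 × M4) × (M4 × M4)) := (Metric.closedBall 0 C ×ˢ Metric.closedBall 0 C) ×ˢ
    ((SE3 ×ˢ se3) ∩ Metric.closedBall (1, 0) r)
  have hK : IsCompact K := ((isCompact_closedBall _ _).prod (isCompact_closedBall _ _)).prod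
    ((isCompact_closedBall _ _).inter_left (isClosed_SE3.prod isClosed_se3))
  have hpK : MapsTo p (Ici t₀) K := fun t ht => by
    have h := hC t (ht₀.trans ht)
    exact ⟨⟨by simpa using h.1, by simpa using h.2⟩, hmem t ht, (hstay t ht).le⟩
  have hKunit : ∀ q ∈ K, IsUnit q.2.1 := fun q hq => isUnit_of_mem_SE3 hq.2.1.1
  obtain ⟨CF, hCF⟩ := hK.exists_bound_of_continuousOn (f := errorField k kb z)
    fun q hq => (contDiffAt_errorField hz' k kb (hKunit q hq) (l := 0)).continuousAt.continuousWithinAt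
  have hp : ∀ t ∈ Ici t₀, HasDerivWithinAt p
      ((X t * A t, -((X t)⁻¹ * (X t * A t) * (X t)⁻¹)), errorField k kb z (p t)) (Ici t₀) t :=
    fun t ht => by
      have hXt := (hX t (ht₀.trans ht)).mono (Ici_subset_Ici.2 ht₀)
      exact (hXt.prodMk (hXt.matrix_inv (isUnit_of_mem_SE3 (hXSE t ht)))).prodMk (hγ t ht)
  have hp' : ∀ t ∈ Ici t₀, ‖((X t * A t, -((X t)⁻¹ * (X t * A t) * (X t)⁻¹)),
      errorField k kb z (p t))‖ ≤ max (max (C * CA) (C * (C * CA) * C)) CF := fun t ht => by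
    have h := hC t (ht₀.trans ht)
    have hA := hCA t (ht₀.trans ht)
    have hCA₀ : 0 ≤ CA := (norm_nonneg _).trans hA
    have hXA : ‖X t * A t‖ ≤ C * CA :=
      (norm_mul_le _ _).trans (mul_le_mul h.1 hA (norm_nonneg _) hC₀)
    refine max_le_max (max_le_max hXA ?_) (hCF _ (hpK ht))
    rw [norm_neg]
    refine (norm_mul_le _ _).trans (mul_le_mul ((norm_mul_le _ _).trans
      (mul_le_mul h.2 hXA (norm_nonneg _) hC₀)) h.2 (norm_nonneg _) (by positivity))
  have hV : ∀ t ∈ Ici t₀, HasDerivWithinAt (fun s => lyapunov k kb z (γ s))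
      (-dissipation k z (γ t).1) (Ici t₀) t := fun t ht => by
    have h := hasDerivWithinAt_lyapunov (c := 1) hkb hz' (hXSE t ht) (hmem t ht)
      ((hγ t ht).congr_deriv (one_smul ℝ _).symm)
    rwa [one_mul] at h
  obtain ⟨l, hl⟩ := AntitoneOn.exists_tendsto_atTop (c := 0)
    (antitoneOn_of_hasDerivWithinAt (convex_Ici t₀) hV
      fun t _ => neg_nonpos.2 (trace_transpose_mul_self_nonneg _))
    fun t ht => lyapunov_nonneg hk hkb hz (isUnit_of_mem_SE3 (hmem t ht).1)
  -- First use of Barbalat: V is nonincreasing and bounded below, and its derivative is uniformly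
  -- continuous.
  have hdiss : Tendsto (fun t => -dissipation k z (γ t).1) atTop (𝓝 0) := by
    have hcont : ContinuousOn (fun q : (M4 × M4) × (M4 × M4) => -dissipation k z q.2.1) K := by
      intro q hq
      have h : ContinuousAt (dissipation k z ∘ fun q : (M4 × M4) × (M4 × M4) => q.2.1) q :=
        ContinuousAt.comp (continuousAt_dissipation hz' (hKunit q hq)) continuousAt_snd.fst
      exact h.neg.continuousWithinAt
    have huc := uniformContinuousOn_comp_of_bounded_deriv hK hcont hp hp' hpK
    exact tendsto_zero_of_hasDerivWithinAt (h := fun _ => 0)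
      (fun t ht => by simpa only [add_zero] using hV t ht) huc tendsto_const_nhds hl
  have hE : Tendsto (fun t => (γ t).1) atTop (𝓝 1) := by
    refine Metric.tendsto_nhds.2 fun ε hε => ?_
    have hK' : IsCompact (SE3 ∩ Metric.closedBall 1 r ∩ {E : M4 | ε ≤ dist E 1}) :=
      ((isCompact_closedBall _ _).inter_left isClosed_SE3).inter_right
        (isClosed_le continuous_const (continuous_id.dist continuous_const))
    -- On the compact set at distance at least ε from 1 the dissipation has a positive lower bound,
    -- so E must eventually leave that set.
    obtain ⟨m, hm, hKm⟩ := hK'.exists_forall_le' (f := dissipation k z) (a := 0)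
      (fun E hE => (continuousAt_dissipation hz' (isUnit_of_mem_SE3 hE.1.1)).continuousWithinAt)
      (fun E hE => by
        refine lt_of_le_of_ne (trace_transpose_mul_self_nonneg _) fun h => ?_
        have h₁ := hr E hE.1.1 hE.1.2 (eq_zero_of_trace_transpose_mul_self h.symm)
        have h₂ : ε ≤ dist E 1 := hE.2
        rw [h₁, dist_self] at h₂
        exact absurd hε (not_lt.2 h₂))
    filter_upwards [hdiss.eventually (lt_mem_nhds (neg_lt_zero.2 hm)), eventually_ge_atTop t₀]
      with t ht htt₀
    by_contra! hge
    have := hKm _ ⟨⟨(hmem t htt₀).1, (le_max_left _ _).trans (hstay t htt₀).le⟩, hge⟩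
    linarith
  have hW : Tendsto (fun t => proj (errorSum k z (γ t).1) * (γ t).1) atTop (𝓝 0) := by
    have h₁ : Tendsto (fun t => errorSum k z (γ t).1) atTop (𝓝 0) := by
      have h := (contDiffAt_errorSum hz' k isUnit_one (l := 0)).continuousAt.tendsto.comp hE
      rwa [errorSum_one hz] at h
    have h₂ := ((continuous_proj.tendsto 0).comp h₁).mul hE
    have h₀ : proj 0 = 0 := projₗ.map_zero
    rwa [h₀, zero_mul] at h₂
  -- Second use of Barbalat, on E itself: the innovation part of its derivative already vanishes at
  -- infinity.
  have hmain : Tendsto (fun t => (γ t).1 * (X t * (γ t).2 * (X t)⁻¹)) atTop (𝓝 0) := by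
    have hcont : Continuous fun q : (M4 × M4) × (M4 × M4) => q.2.1 * (q.1.1 * q.2.2 * q.1.2) := by
      fun_prop
    have huc := uniformContinuousOn_comp_of_bounded_deriv hK hcont.continuousOn hp hp' hpK
    exact tendsto_zero_of_hasDerivWithinAt
      (fun t ht => (hγ t ht).linearMap_comp (LinearMap.fst ℝ M4 M4)) huc hW hE
  have hconj : Tendsto (fun t => X t * (γ t).2 * (X t)⁻¹) atTop (𝓝 0) := by
    have hinv : Tendsto (fun t => (γ t).1.adjugate) atTop (𝓝 (1 : M4).adjugate) :=
      ((Continuous.matrix_adjugate continuous_id).tendsto 1).comp hE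
    have h := hinv.mul hmain
    rw [mul_zero] at h
    refine h.congr' ?_
    filter_upwards [eventually_ge_atTop t₀] with t ht
    rw [← inv_eq_adjugate_of_mem_SE3 (hmem t ht).1, ← mul_assoc,
      inv_mul_of_mem_SE3 (hmem t ht).1, one_mul]
  have hb : Tendsto (fun t => (γ t).2) atTop (𝓝 0) := by
    have hbound : Tendsto (fun t => C * ‖X t * (γ t).2 * (X t)⁻¹‖ * C) atTop (𝓝 0) := by
      simpa using (hconj.norm.const_mul C).mul_const C
    refine squeeze_zero_norm' ?_ hbound
    filter_upwards [eventually_ge_atTop t₀] with t ht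
    have h := hC t (ht₀.trans ht)
    have hXX := inv_mul_of_mem_SE3 (hXSE t ht)
    calc ‖(γ t).2‖ = ‖(X t)⁻¹ * (X t * (γ t).2 * (X t)⁻¹) * X t‖ := by
          rw [mul_assoc (X t), ← mul_assoc (X t)⁻¹, hXX, one_mul, mul_assoc, hXX, mul_one]
      _ ≤ ‖(X t)⁻¹‖ * ‖X t * (γ t).2 * (X t)⁻¹‖ * ‖X t‖ :=
          (norm_mul_le _ _).trans (mul_le_mul_of_nonneg_right (norm_mul_le _ _) (norm_nonneg _))
      _ ≤ C * ‖X t * (γ t).2 * (X t)⁻¹‖ * C := by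
          gcongr
          · exact h.2
          · exact h.1
  exact hE.prodMk_nhds hb

end PoseObserver

theorem proposition1 {N : ℕ}
    (k : Fin N → ℝ) (hk : ∀ i, 0 < k i) (kb : ℝ) (hkb : 0 < kb)
    (z : Fin N → PoseObserver.V4) (hz : ∀ i, z i ⬝ᵥ z i = 1)
    (X A : ℝ → PoseObserver.M4)
    (hXmem : ∀ t, 0 ≤ t → X t ∈ PoseObserver.SE3)
    (hAmem : ∀ t, 0 ≤ t → A t ∈ PoseObserver.se3)
    (hAcont : ContinuousOn A (Ici 0))
    (hX : ∀ t, 0 ≤ t → HasDerivWithinAt X (X t * A t) (Ici 0) t)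
    (b : PoseObserver.M4) (hb : b ∈ PoseObserver.se3)
    (hobs : PoseObserver.Observable z)
    (hG : IsUnit (PoseObserver.matG k z)) (hH : IsUnit (PoseObserver.matH k z))
    (hAbdd : ∃ C : ℝ, ∀ t, 0 ≤ t → ‖A t‖ ≤ C)
    (hXbdd : ∃ C : ℝ, ∀ t, 0 ≤ t → ‖X t‖ ≤ C) :
    PoseObserver.IsLocallyAsymptoticallyStable (PoseObserver.SE3 ×ˢ PoseObserver.se3)
      (PoseObserver.IsErrorTrajectory k kb z X A b) (1, 0) := by
  open PoseObserver in
  have hz' (i : Fin N) := ne_zero_of_dotProduct_self_eq_one (hz i)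
  obtain ⟨r, hr₀, hr⟩ := exists_isolated_zero hk hz hG hH
  have hXcont : ContinuousOn X (Ici 0) := fun t ht => (hX t ht).continuousWithinAt
  refine ⟨fun t₀ ht₀ => ?_, fun t₀ ht₀ => ?_, fun ε hε t₀ ht₀ => ?_, fun t₀ ht₀ => ?_⟩
  · refine isErrorTrajectory_of_hasDerivWithinAt hz' hXmem hX hb (Ici_subset_Ici.2 ht₀)
      self_mem_Ici ⟨one_mem_SE3, se3Submodule.zero_mem⟩ fun t _ => ?_
    refine (hasDerivWithinAt_const t _ _).congr_deriv ?_
    have h₀ : proj 0 = 0 := projₗ.map_zero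
    simp [errorField, errorSum_one hz, h₀, Prod.ext_iff]
  · obtain ⟨δ, hδ, h⟩ := exists_global_solution hk hkb hz hr₀ hr hXmem hXcont hXbdd ht₀
    refine ⟨δ, hδ, fun x₀ hx₀ hdist => ?_⟩
    obtain ⟨γ, hγ₀, hγ⟩ := h x₀ hx₀ hdist
    exact ⟨γ, isErrorTrajectory_of_hasDerivWithinAt hz' hXmem hX hb (Ici_subset_Ici.2 ht₀)
      self_mem_Ici (hγ₀ ▸ hx₀) hγ, hγ₀⟩
  -- The trap needs a radius at most `r`, where 1 is the only zero of the innovation.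
  · obtain ⟨δ, hδ, htrap⟩ := exists_trapping hk hkb hz hr (lt_min hε hr₀) (min_le_right _ _)
    refine ⟨δ, hδ, fun T hT γ hγ h₀ t ht => ?_⟩
    have hJ₀ : Ico t₀ T ⊆ Ici 0 := fun s hs => ht₀.trans hs.1
    have h := hγ.mem_and_hasDerivWithinAt hz' hXmem hAmem hX hb (convex_Ico t₀ T) hJ₀ ⟨le_rfl, hT⟩
    exact (htrap (Ico t₀ T) t₀ γ X (fun _ => 1) (convex_Ico t₀ T) ⟨le_rfl, hT⟩
      Ico_subset_Ici_self (fun _ _ => zero_le_one) (fun s hs => hXmem s (hJ₀ hs))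
      (fun s hs => (h s hs).1) (fun s hs => (h s hs).2.congr_deriv (one_smul ℝ _).symm) h₀ t
      ht).trans_le (min_le_left _ _)
  · obtain ⟨δ, hδ, htrap⟩ := exists_trapping hk hkb hz hr hr₀ le_rfl
    refine ⟨δ, hδ, fun γ hγ h₀ => ?_⟩
    have hJ₀ : Ici t₀ ⊆ Ici 0 := Ici_subset_Ici.2 ht₀
    have h := hγ.mem_and_hasDerivWithinAt hz' hXmem hAmem hX hb (convex_Ici t₀) hJ₀ self_mem_Ici
    refine tendsto_of_solution hk hkb hz hr hXmem hX hAbdd hXbdd ht₀ (fun s hs => (h s hs).1)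
      (fun s hs => (h s hs).2) ?_
    exact htrap (Ici t₀) t₀ γ X (fun _ => 1) (convex_Ici t₀) self_mem_Ici subset_rfl
      (fun _ _ => zero_le_one) (fun s hs => hXmem s (hJ₀ hs)) (fun s hs => (h s hs).1)
      (fun s hs => (h s hs).2.congr_deriv (one_smul ℝ _).symm) h₀
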